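/- Let $n\ge2$, let $\mathbf B^n=\{x\in\mathbb R^n:|x|<1\}$ be the open unit ball, and let $d\sigma$ be the normalized surface measure on the unit sphere $\partial\mathbf B^n$, with $\|\cdot\|_{\partial\mathbf B^n}$ the norm of $L^2(\partial\mathbf B^n,d\sigma)$. Every (complex-valued) harmonic function $f$ on $\mathbf B^n$ has a unique decomposition $f=\sum_{p=0}^\infty f_p$, converging uniformly on compact subsets of $\mathbf B^n$, where $f_p$ is a harmonic polynomial on $\mathbb R^n$ homogeneous of degree $p$. Put $$\|f\|_\square^2:=\sum_{p=0}^\infty p\,\frac{(n/2)_p}{p!}\,\|f_p\|^2_{\partial\mathbf B^n}\in[0,\infty],\qquad (x)_p:=x(x+1)\cdots(x+p-1),$$ and let the harmonic Dirichlet space $\mathcal H_\square$ be the set of all harmonic $f$ on $\mathbf B^n$ with $\|f\|_\square<\infty$. For $s>-1$ let $\|\cdot\|_s$ be the norm of $L^2(\mathbf B^n,d\rho_s)$, where $$d\rho_s(x)=\frac{\Gamma(\frac n2+s+1)}{\pi^{n/2}\,\Gamma(s+1)}(1-|x|^2)^s\,dx.$$ Let $\mathcal X_1,\dots,\mathcal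 X_{n(n-1)}$ be the vector fields $X_{jk}=x_j\partial_k-x_k\partial_j$, $1\le j,k\le n$, $j\ne k$, in some order, and for an integer $m>\frac n4$ (so that $2m-\frac n2-1>-1$) put $$S_m(f):=\sum_{j_1,\dots,j_m=1}^{n(n-1)}\|\mathcal X_{j_1}\cdots\mathcal X_{j_m}f\|^2_{2m-\frac n2-1}\in[0,\infty].$$ Theorem. For every harmonic function $f$ on $\mathbf B^n$, the following are equivalent: (i) $f\in\mathcal H_\square$; (ii) $S_m(f)<\infty$ for some integer $m>\frac n4$; (iii) $S_m(f)<\infty$ for every integer $m>\frac n4$. Furthermore, $\mathcal H_\square$ is a complex vector space, $\|\cdot\|_\square$ is a seminorm on it, and for every integer $m>\frac n4$ the function $f\mapsto S_m(f)^{1/2}$ is a seminorm on $\mathcal H_\square$ equivalent to $\|\cdot\|_\square$: there are constants $c,C>0$ depending only on $n$ and $m$ such that $c\,\|f\|_\square\le S_m(f)^{1/2}\le C\,\|f\|_\square$ for all $f\in\mathcal H_\square$. -/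

import Mathlib

open MeasureTheory Metric Filter Topology InnerProductSpace
open scoped ENNReal Nat

noncomputable section

namespace HarmonicDirichlet

/-- Real Euclidean space `ℝⁿ`. -/
abbrev E (n : ℕ) : Type := EuclideanSpace ℝ (Fin n)

/-- The function `g` on `ℝⁿ` is a harmonic polynomial (with complex coefficients),
homogeneous of degree `p`. -/
def IsSolidHarmonic (n p : ℕ) (g : E n → ℂ) : Prop :=
  (∃ P : MvPolynomial (Fin n) ℂ, P.IsHomogeneous p ∧
    ∀ x : E n, g x = MvPolynomial.eval (fun i => (x i : ℂ)) P) ∧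
  HarmonicOnNhd g Set.univ

/-- `f = ∑ₚ F p` on the open unit ball, where `F p` is a harmonic polynomial homogeneous of
degree `p` and the sum converges uniformly on compact subsets of the ball. -/
structure IsHarmonicExpansion (n : ℕ) (f : E n → ℂ) (F : ℕ → E n → ℂ) : Prop where
  solid : ∀ p, IsSolidHarmonic n p (F p)
  tendsto : TendstoLocallyUniformlyOn (fun (N : ℕ) (x : E n) => ∑ p ∈ Finset.range N, F p x) f
    atTop (ball (0 : E n) 1)

/-- The components `f_p` in the (unique) decomposition `f = ∑ₚ f_p` of a function that is harmonic
on the unit ball. -/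
def component (n : ℕ) (f : E n → ℂ) : ℕ → E n → ℂ :=
  Classical.epsilon (fun F : ℕ → E n → ℂ => IsHarmonicExpansion n f F)

/-- The normalized surface measure `dσ` on the unit sphere. -/
def sphereMeasure (n : ℕ) : Measure (sphere (0 : E n) 1) :=
  ((volume : Measure (E n)).toSphere Set.univ)⁻¹ • (volume : Measure (E n)).toSphere

/-- The squared norm of (the restriction of) `g` in `L²` of the unit sphere, with values
in `[0, ∞]`. -/
def sphereNormSq (n : ℕ) (g : E n → ℂ) : ℝ≥0∞ :=
  ∫⁻ ζ : sphere (0 : E n) 1, ‖g (ζ : E n)‖ₑ ^ 2 ∂(sphereMeasure n)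

/-- The coefficient `p (n/2)_p / p!`, where `(x)_p = x (x + 1) ⋯ (x + p - 1)`. -/
def dirichletCoeff (n p : ℕ) : ℝ :=
  (p : ℝ) * (ascPochhammer ℝ p).eval ((n : ℝ) / 2) / (p ! : ℝ)

/-- The quantity `∑ₚ (p (n/2)_p / p!) ‖f_p‖²` (the square of the Dirichlet seminorm), with values
in `[0, ∞]`. -/
def dirichletNormSq (n : ℕ) (f : E n → ℂ) : ℝ≥0∞ :=
  ∑' p : ℕ, ENNReal.ofReal (dirichletCoeff n p) * sphereNormSq n (component n f p)

/-- The harmonic Dirichlet space: the functions harmonic on the unit ball whose Dirichlet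
seminorm is finite. -/
def harmonicDirichletSpace (n : ℕ) : Set (E n → ℂ) :=
  {f | HarmonicOnNhd f (ball (0 : E n) 1) ∧ dirichletNormSq n f < ∞}

/-- The measure
`dρ_s(x) = Γ(n/2 + s + 1) / (π^(n/2) Γ(s + 1)) (1 - |x|²)^s dx` on the open unit ball. -/
def ballMeasure (n : ℕ) (s : ℝ) : Measure (E n) :=
  ((volume : Measure (E n)).restrict (ball (0 : E n) 1)).withDensity fun x =>
    ENNReal.ofReal (Real.Gamma ((n : ℝ) / 2 + s + 1) /
      (Real.pi ^ ((n : ℝ) / 2) * Real.Gamma (s + 1)) * (1 - ‖x‖ ^ 2) ^ s)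

/-- The squared norm of `g` in `L²(dρ_s)`, with values in `[0, ∞]`. -/
def ballNormSq (n : ℕ) (s : ℝ) (g : E n → ℂ) : ℝ≥0∞ :=
  ∫⁻ x, ‖g x‖ₑ ^ 2 ∂(ballMeasure n s)

/-- The partial derivative `∂_k g`. -/
def partialDeriv (n : ℕ) (k : Fin n) (g : E n → ℂ) : E n → ℂ :=
  fun x => fderiv ℝ g x (EuclideanSpace.single k (1 : ℝ))

/-- Ordered pairs `(j, k)` with `j ≠ k`; there are `n (n - 1)` of them. -/
abbrev PairIndex (n : ℕ) : Type := {a : Fin n × Fin n // a.1 ≠ a.2}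

/-- The tangential vector field `X_{jk} = x_j ∂_k - x_k ∂_j`. -/
def tangential (n : ℕ) (a : PairIndex n) (g : E n → ℂ) : E n → ℂ :=
  fun x => (x a.1.1 : ℂ) * partialDeriv n a.1.2 g x - (x a.1.2 : ℂ) * partialDeriv n a.1.1 g x

/-- The composition `X_{J 0} X_{J 1} ⋯ X_{J (m - 1)} f`. -/
def iteratedTangential (n m : ℕ) (J : Fin m → PairIndex n) (f : E n → ℂ) : E n → ℂ :=
  (List.ofFn J).foldr (tangential n) f

/-- The sum over all `m`-tuples of tangential fields of
`‖X_{j₁} ⋯ X_{jₘ} f‖²` in `L²(dρ_s)` with `s = 2 m - n / 2 - 1`. -/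
def tangentialNormSq (n m : ℕ) (f : E n → ℂ) : ℝ≥0∞ :=
  ∑ J : Fin m → PairIndex n,
    ballNormSq n (2 * (m : ℝ) - (n : ℝ) / 2 - 1) (iteratedTangential n m J f)

end HarmonicDirichlet

end

/-!
Existence of the expansion `f = ∑ₚ f_p` is the density of harmonic polynomials: on a sphere every
polynomial agrees with a harmonic one, polynomials are dense among the continuous functions on the
sphere by Stone–Weierstrass, and the maximum principle carries the approximation inside.

The operator `∑ X_{jk}²` multiplies `f_p` by `-2p(p + n - 2)`, and each `X_{jk}` is skew-symmetric
on the unit sphere. Hence components of different degrees are orthogonal on spheres, and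
`∑ ‖X_{j₁} ⋯ X_{jₘ} f_p‖²` is `(2p(p + n - 2))^m ‖f_p‖²`. Integrating radially against
`(1 - |x|²)^(2m - n/2 - 1)` gives `S_m(f) = ∑ₚ (2p(p + n - 2))^m (n/2)_p / (2m)_p ‖f_p‖²`, whose
weights are comparable to `p (n/2)_p / p!` because `(2m)_p / p!` grows like `p^(2m - 1)`.
-/

noncomputable section

namespace HarmonicDirichlet

section PolynomialAlgebra

open MvPolynomial

variable {σ R S : Type*} [CommRing R] [CommRing S]

lemma pderiv_comm (i j : σ) (P : MvPolynomial σ R) :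
    pderiv i (pderiv j P) = pderiv j (pderiv i P) := by
  classical
  have hcommutator : ⁅(pderiv i : Derivation R (MvPolynomial σ R) (MvPolynomial σ R)),
      (pderiv j : Derivation R (MvPolynomial σ R) (MvPolynomial σ R))⁆ = 0 := by
    ext1 k
    simp [Derivation.commutator_apply, pderiv_X, Pi.single_apply, apply_ite]
  simpa [Derivation.commutator_apply, sub_eq_zero] using congr($hcommutator P)

/-- The derivation `X_j ∂_k - X_k ∂_j`, the algebraic counterpart of `tangential`. -/
def rotDeriv (j k : σ) : Derivation R (MvPolynomial σ R) (MvPolynomial σ R) :=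
  (X j : MvPolynomial σ R) • pderiv k - (X k : MvPolynomial σ R) • pderiv j

lemma rotDeriv_apply (j k : σ) (P : MvPolynomial σ R) :
    rotDeriv j k P = X j * pderiv k P - X k * pderiv j P := rfl

@[simp] lemma rotDeriv_self (j : σ) : (rotDeriv j j : Derivation R (MvPolynomial σ R) _) = 0 :=
  sub_self _

lemma rotDeriv_rotDeriv [DecidableEq σ] (j k : σ) (P : MvPolynomial σ R) :
    rotDeriv j k (rotDeriv j k P) =
      X j ^ 2 * pderiv k (pderiv k P) + X k ^ 2 * pderiv j (pderiv j P)
        - X j * (X k * pderiv k (pderiv j P)) - X k * (X j * pderiv j (pderiv k P))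
        - X j * pderiv j P - X k * pderiv k P
        + if j = k then X j * pderiv k P + X k * pderiv j P else 0 := by
  simp only [rotDeriv_apply, map_sub, Derivation.leibniz, smul_eq_mul, pderiv_X, Pi.single_apply]
  obtain rfl | h := eq_or_ne j k
  · simp
    ring
  · simp only [h, h.symm, if_false, if_true]
    ring

lemma map_rotDeriv (f : R →+* S) (j k : σ) (P : MvPolynomial σ R) :
    map f (rotDeriv j k P) = rotDeriv j k (map f P) := by
  simp only [rotDeriv_apply, pderiv_map, map_sub, map_mul, map_X]

lemma isHomogeneous_rotDeriv {P : MvPolynomial σ R} {p : ℕ} (hP : P.IsHomogeneous p) (j k : σ) :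
    (rotDeriv j k P).IsHomogeneous p := by
  obtain _ | p := p
  · rw [← totalDegree_zero_iff_isHomogeneous, totalDegree_eq_zero_iff_eq_C] at hP
    rw [hP, rotDeriv_apply, pderiv_C, pderiv_C]
    simpa using isHomogeneous_zero σ R 0
  · have hX (i l : σ) : (X i * pderiv l P).IsHomogeneous (p + 1) := by
      simpa [add_comm] using (isHomogeneous_X R i).mul (hP.pderiv (i := l))
    exact (hX j k).sub (hX k j)

lemma pderiv_homogeneousComponent_succ (p : ℕ) (k : σ) (P : MvPolynomial σ R) :
    pderiv k (homogeneousComponent (p + 1) P) = homogeneousComponent p (pderiv k P) := by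
  ext d
  simp only [coeff_pderiv, coeff_homogeneousComponent, map_add, Finsupp.degree_single,
    add_left_inj]
  split_ifs <;> simp

lemma totalDegree_pderiv_le (k : σ) (P : MvPolynomial σ R) :
    (pderiv k P).totalDegree ≤ P.totalDegree - 1 := by
  refine Finset.sup_le fun m hm => ?_
  rw [mem_support_iff, coeff_pderiv] at hm
  have hle := le_totalDegree (mem_support_iff.2 (left_ne_zero_of_mul hm))
  rw [Finsupp.sum_add_index' (by simp) (by simp), Finsupp.sum_single_index rfl] at hle
  omega

lemma eval_smul_of_isHomogeneous {P : MvPolynomial σ R} {p : ℕ} (hP : P.IsHomogeneous p) (r : R)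
    (x : σ → R) : eval (r • x) P = r ^ p * eval x P := by
  simp only [eval_eq, Pi.smul_apply, smul_eq_mul, mul_pow, Finset.prod_mul_distrib,
    Finset.prod_pow_eq_pow_sum, Finset.mul_sum]
  refine Finset.sum_congr rfl fun d hd => ?_
  rw [← hP.degree_eq_sum_deg_support hd]
  ring

variable [Fintype σ]

/-- The formal Laplacian `∑ₖ ∂ₖ²` of a polynomial. -/
def polyLaplacian : MvPolynomial σ R →ₗ[R] MvPolynomial σ R :=
  ∑ k, (pderiv k).toLinearMap ∘ₗ (pderiv k).toLinearMap

lemma polyLaplacian_apply (P : MvPolynomial σ R) :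
    polyLaplacian P = ∑ k, pderiv k (pderiv k P) := by
  simp [polyLaplacian]

lemma polyLaplacian_pderiv (i : σ) (P : MvPolynomial σ R) :
    polyLaplacian (pderiv i P) = pderiv i (polyLaplacian P) := by
  simp only [polyLaplacian_apply, map_sum, pderiv_comm _ i]

lemma polyLaplacian_mul (P Q : MvPolynomial σ R) :
    polyLaplacian (P * Q) =
      polyLaplacian P * Q + 2 * ∑ k, pderiv k P * pderiv k Q + P * polyLaplacian Q := by
  simp only [polyLaplacian_apply, Derivation.leibniz, smul_eq_mul, map_add, Finset.sum_mul,
    Finset.mul_sum, ← Finset.sum_add_distrib]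
  exact Finset.sum_congr rfl fun k _ => by ring

lemma polyLaplacian_X (i : σ) : polyLaplacian (X i : MvPolynomial σ R) = 0 := by
  classical
  simp [polyLaplacian_apply, pderiv_X, Pi.single_apply, apply_ite]

lemma polyLaplacian_X_mul (i : σ) (P : MvPolynomial σ R) :
    polyLaplacian (X i * P) = 2 * pderiv i P + X i * polyLaplacian P := by
  classical
  simp [polyLaplacian_mul, polyLaplacian_X, pderiv_X, Pi.single_apply]

lemma polyLaplacian_rotDeriv (j k : σ) (P : MvPolynomial σ R) :
    polyLaplacian (rotDeriv j k P) = rotDeriv j k (polyLaplacian P) := by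
  simp only [rotDeriv_apply, map_sub, polyLaplacian_X_mul, polyLaplacian_pderiv, pderiv_comm j k]
  ring

lemma polyLaplacian_map (f : R →+* S) (P : MvPolynomial σ R) :
    polyLaplacian (map f P) = map f (polyLaplacian P) := by
  simp only [polyLaplacian_apply, pderiv_map, map_sum]

lemma polyLaplacian_homogeneousComponent_add_two (p : ℕ) (P : MvPolynomial σ R) :
    polyLaplacian (homogeneousComponent (p + 2) P) = homogeneousComponent p (polyLaplacian P) := by
  simp only [polyLaplacian_apply, pderiv_homogeneousComponent_succ, map_sum]

lemma totalDegree_polyLaplacian_le (P : MvPolynomial σ R) :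
    (polyLaplacian P).totalDegree ≤ P.totalDegree - 2 := by
  rw [polyLaplacian_apply]
  exact totalDegree_finsetSum_le fun k _ => (totalDegree_pderiv_le k _).trans
    (Nat.sub_le_sub_right (totalDegree_pderiv_le k P) 1)

lemma sum_X_mul_sum_X_mul_pderiv_pderiv {P : MvPolynomial σ R} {p : ℕ} (hP : P.IsHomogeneous p) :
    ∑ j, X j * ∑ k, X k * pderiv k (pderiv j P) = (p * (p - 1) : ℕ) • P := by
  simp only [hP.pderiv.sum_X_mul_pderiv, mul_smul_comm, ← Finset.smul_sum, hP.sum_X_mul_pderiv,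
    smul_smul, mul_comm]

/-- The Casimir operator `∑_{j,k} (X_j ∂_k - X_k ∂_j)²`: up to the factor `2`, the Laplacian of the
spheres centred at the origin. -/
def casimir : MvPolynomial σ R →ₗ[R] MvPolynomial σ R :=
  ∑ j, ∑ k, (rotDeriv j k).toLinearMap ∘ₗ (rotDeriv j k).toLinearMap

lemma casimir_apply (P : MvPolynomial σ R) :
    casimir P = ∑ j, ∑ k, rotDeriv j k (rotDeriv j k P) := by
  simp [casimir]

lemma casimir_of_isHomogeneous {P : MvPolynomial σ R} {p : ℕ} (hP : P.IsHomogeneous p) :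
    casimir P = 2 * (psum σ R 2 * polyLaplacian P) -
      (2 * (p * (p + Fintype.card σ - 2)) : R) • P := by
  classical
  have hsq : ∑ j : σ, ∑ k : σ, X j ^ 2 * pderiv k (pderiv k P) = psum σ R 2 * polyLaplacian P := by
    simp [psum, polyLaplacian_apply, Finset.sum_mul_sum]
  have hmixed : ∑ j : σ, ∑ k : σ, X j * (X k * pderiv k (pderiv j P)) =
      (p * (p - 1) : ℕ) • P := by
    simpa only [Finset.mul_sum] using sum_X_mul_sum_X_mul_pderiv_pderiv hP
  have hsq' := Finset.sum_comm.trans hsq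
  have hmixed' := Finset.sum_comm.trans hmixed
  simp only [casimir_apply, rotDeriv_rotDeriv, Finset.sum_add_distrib, Finset.sum_sub_distrib, hsq,
    hsq', hmixed, hmixed', Finset.sum_ite_eq, Finset.mem_univ, if_true, Finset.sum_const,
    Finset.card_univ, ← Finset.smul_sum, hP.sum_X_mul_pderiv]
  cases p <;> simp only [smul_eq_C_mul, nsmul_eq_mul, map_mul, map_add, map_sub, map_ofNat,
    map_natCast] <;> push_cast <;> ring

/-- Harmonic polynomials that are homogeneous of degree `p`. -/
def solidHarmonic (σ R : Type*) [Fintype σ] [CommRing R] (p : ℕ) :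
    Submodule R (MvPolynomial σ R) :=
  homogeneousSubmodule σ R p ⊓ LinearMap.ker polyLaplacian

lemma mem_solidHarmonic {p : ℕ} {P : MvPolynomial σ R} :
    P ∈ solidHarmonic σ R p ↔ P.IsHomogeneous p ∧ polyLaplacian P = 0 := by
  simp [solidHarmonic]

variable {p : ℕ} {P : MvPolynomial σ R}

lemma rotDeriv_mem_solidHarmonic (hP : P ∈ solidHarmonic σ R p) (j k : σ) :
    rotDeriv j k P ∈ solidHarmonic σ R p := by
  rw [mem_solidHarmonic] at hP ⊢
  exact ⟨isHomogeneous_rotDeriv hP.1 j k, by rw [polyLaplacian_rotDeriv, hP.2, map_zero]⟩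

lemma pderiv_mem_solidHarmonic (hP : P ∈ solidHarmonic σ R p) (k : σ) :
    pderiv k P ∈ solidHarmonic σ R (p - 1) := by
  rw [mem_solidHarmonic] at hP ⊢
  exact ⟨hP.1.pderiv, by rw [polyLaplacian_pderiv, hP.2, map_zero]⟩

lemma map_mem_solidHarmonic (hP : P ∈ solidHarmonic σ R p) (f : R →+* S) :
    map f P ∈ solidHarmonic σ S p := by
  rw [mem_solidHarmonic] at hP ⊢
  exact ⟨hP.1.map f, by rw [polyLaplacian_map, hP.2, map_zero]⟩

lemma homogeneousComponent_mem_solidHarmonic (hP : polyLaplacian P = 0) (p : ℕ) :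
    homogeneousComponent p P ∈ solidHarmonic σ R p := by
  refine mem_solidHarmonic.2 ⟨homogeneousComponent_isHomogeneous p P, ?_⟩
  obtain _ | _ | p := p
  · simp [polyLaplacian_apply]
  · simp [polyLaplacian_apply, pderiv_homogeneousComponent_succ]
  · rw [polyLaplacian_homogeneousComponent_add_two, hP, map_zero]

lemma casimir_of_mem_solidHarmonic (hP : P ∈ solidHarmonic σ R p) :
    casimir P = (-(2 * (p * (p + Fintype.card σ - 2))) : R) • P := by
  rw [mem_solidHarmonic] at hP
  rw [casimir_of_isHomogeneous hP.1, hP.2, mul_zero, mul_zero, zero_sub, neg_smul]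

end PolynomialAlgebra

section Laplacian

open Laplacian

variable {V F ι : Type*} [NormedAddCommGroup V] [InnerProductSpace ℝ V] [FiniteDimensional ℝ V]
  [NormedAddCommGroup F] [NormedSpace ℝ F] [Fintype ι]

lemma laplacian_eq_sum_fderiv_fderiv (v : OrthonormalBasis ι ℝ V) {f : V → F} {x : V}
    (hf : ContDiffAt ℝ 2 f x) :
    Δ f x = ∑ i, fderiv ℝ (fun y => fderiv ℝ f y (v i)) x (v i) := by
  have hdiff : DifferentiableAt ℝ (fderiv ℝ f) x :=
    (hf.fderiv_right (m := 1) (by norm_num)).differentiableAt one_ne_zero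
  simp [laplacian_eq_iteratedFDeriv_orthonormalBasis f v, iteratedFDeriv_two_apply,
    fderiv_clm_apply hdiff (differentiableAt_const _)]

end Laplacian

section PolynomialFunctions

open MvPolynomial Laplacian

variable {n : ℕ} {P Q : MvPolynomial (Fin n) ℂ} {p : ℕ} {g : E n → ℂ}

/-- The function on `ℝⁿ` defined by a polynomial with complex coefficients. -/
def polyFun : MvPolynomial (Fin n) ℂ →ₐ[ℂ] (E n → ℂ) :=
  aeval fun i x => (x i : ℂ)

lemma polyFun_apply (P : MvPolynomial (Fin n) ℂ) (x : E n) :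
    polyFun P x = eval (fun i => (x i : ℂ)) P := by
  induction P using MvPolynomial.induction_on with
  | C c => simp [polyFun]
  | add P Q hP hQ => simp [hP, hQ]
  | mul_X P i hP =>
    rw [map_mul, Pi.mul_apply, hP]
    simp [polyFun]

@[simp] lemma polyFun_X (i : Fin n) (x : E n) : polyFun (X i) x = x i := by
  simp [polyFun_apply]

@[simp] lemma polyFun_C (c : ℂ) (x : E n) : polyFun (C c : MvPolynomial (Fin n) ℂ) x = c := by
  simp [polyFun_apply]

lemma polyFun_injective : Function.Injective (polyFun : MvPolynomial (Fin n) ℂ → E n → ℂ) := by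
  intro P Q h
  refine MvPolynomial.funext_set (fun _ => Set.range ((↑) : ℝ → ℂ))
    (fun _ => Set.infinite_range_of_injective Complex.ofReal_injective) fun y hy => ?_
  choose x hx using fun i => hy i trivial
  simpa [polyFun_apply, hx] using congr_fun h (WithLp.toLp 2 x)

lemma polyFun_psum_two (x : E n) : polyFun (psum (Fin n) ℂ 2) x = (‖x‖ : ℂ) ^ 2 := by
  rw [← Complex.ofReal_pow, EuclideanSpace.real_norm_sq_eq, psum, map_sum, Finset.sum_apply]
  push_cast
  simp

lemma polyFun_map_conj (P : MvPolynomial (Fin n) ℂ) (x : E n) :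
    polyFun (map (starRingEnd ℂ) P) x = starRingEnd ℂ (polyFun P x) := by
  simp [polyFun_apply, ← eval₂_id, hom_eval₂, eval₂_map]

lemma polyFun_smul_of_isHomogeneous (hP : P.IsHomogeneous p) (r : ℝ) (x : E n) :
    polyFun P (r • x) = (r : ℂ) ^ p * polyFun P x := by
  simpa [polyFun_apply, Pi.smul_def] using
    eval_smul_of_isHomogeneous hP (r : ℂ) fun i => (x i : ℂ)

lemma contDiff_polyFun {m : WithTop ℕ∞} (P : MvPolynomial (Fin n) ℂ) :
    ContDiff ℝ m (polyFun P) := by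
  have h := AnalyticOnNhd.eval_continuousLinearMap'
    (fun i => Complex.ofRealCLM ∘L (EuclideanSpace.proj i : E n →L[ℝ] ℝ)) P
  exact (funext (polyFun_apply P) ▸ h.contDiff :)

lemma continuous_polyFun (P : MvPolynomial (Fin n) ℂ) : Continuous (polyFun P) :=
  (contDiff_polyFun P (m := 0)).continuous

lemma hasFDerivAt_polyFun (P : MvPolynomial (Fin n) ℂ) (x : E n) :
    HasFDerivAt (polyFun P)
      (∑ k, (EuclideanSpace.proj k : E n →L[ℝ] ℝ).smulRight (polyFun (pderiv k P) x)) x := by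
  induction P using MvPolynomial.induction_on with
  | C c =>
    simpa [show polyFun (C c : MvPolynomial (Fin n) ℂ) = fun _ => c from funext (polyFun_C c)]
      using hasFDerivAt_const c x
  | add P Q hP hQ =>
    rw [map_add]
    convert! hP.add hQ using 1
    ext v
    simp [Finset.sum_add_distrib]
  | mul_X P i hP =>
    have hX : HasFDerivAt (fun y : E n => ((y i : ℝ) : ℂ))
        (Complex.ofRealCLM ∘L (EuclideanSpace.proj i : E n →L[ℝ] ℝ)) x :=
      (Complex.ofRealCLM ∘L (EuclideanSpace.proj i : E n →L[ℝ] ℝ)).hasFDerivAt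
    rw [map_mul, show polyFun (X i) = fun y : E n => ((y i : ℝ) : ℂ) from funext (polyFun_X i)]
    convert! hP.mul hX using 1
    classical
    ext v
    simp [Derivation.leibniz, pderiv_X, Pi.single_apply, apply_ite polyFun, ite_apply,
      Finset.sum_add_distrib, Finset.mul_sum, mul_left_comm, mul_comm]

lemma partialDeriv_polyFun (k : Fin n) (P : MvPolynomial (Fin n) ℂ) :
    partialDeriv n k (polyFun P) = polyFun (pderiv k P) := by
  ext x
  simp [partialDeriv, (hasFDerivAt_polyFun P x).fderiv]

lemma tangential_polyFun (a : PairIndex n) (P : MvPolynomial (Fin n) ℂ) :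
    tangential n a (polyFun P) = polyFun (rotDeriv a.1.1 a.1.2 P) := by
  ext x
  simp [tangential, partialDeriv_polyFun, rotDeriv_apply]

lemma laplacian_polyFun (P : MvPolynomial (Fin n) ℂ) :
    Δ (polyFun P) = polyFun (polyLaplacian P) := by
  ext x
  have hpartial (k : Fin n) (P : MvPolynomial (Fin n) ℂ) :
      (fun y => fderiv ℝ (polyFun P) y (EuclideanSpace.basisFun (Fin n) ℝ k)) =
        polyFun (pderiv k P) := by
    simp only [EuclideanSpace.basisFun_apply]
    exact partialDeriv_polyFun k P
  rw [laplacian_eq_sum_fderiv_fderiv (EuclideanSpace.basisFun (Fin n) ℝ)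
    (contDiff_polyFun P).contDiffAt]
  simp only [hpartial, fun k => congr_fun (hpartial k (pderiv k P)) x, polyLaplacian_apply, map_sum,
    Finset.sum_apply]

lemma harmonicOnNhd_polyFun_iff : HarmonicOnNhd (polyFun P) Set.univ ↔ polyLaplacian P = 0 := by
  constructor
  · intro h
    refine polyFun_injective (funext fun x => ?_)
    rw [← laplacian_polyFun, (h x trivial).2.self_of_nhds, map_zero, Pi.zero_apply]
  · intro h x _
    exact ⟨(contDiff_polyFun P).contDiffAt, by rw [laplacian_polyFun, h, map_zero]⟩

lemma isSolidHarmonic_iff :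
    IsSolidHarmonic n p g ↔ ∃ P ∈ solidHarmonic (Fin n) ℂ p, polyFun P = g := by
  constructor
  · rintro ⟨⟨P, hP, hg⟩, hharm⟩
    have hPg : polyFun P = g := funext fun x => by rw [hg, polyFun_apply]
    exact ⟨P, mem_solidHarmonic.2 ⟨hP, harmonicOnNhd_polyFun_iff.1 (hPg ▸ hharm)⟩, hPg⟩
  · rintro ⟨P, hP, rfl⟩
    rw [mem_solidHarmonic] at hP
    exact ⟨⟨P, hP.1, fun x => by rw [polyFun_apply]⟩, harmonicOnNhd_polyFun_iff.2 hP.2⟩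

end PolynomialFunctions

section SphereIsometry

variable {V : Type*} [NormedAddCommGroup V] [NormedSpace ℝ V]

/-- The action of a linear isometry on the unit sphere. -/
def sphereMap (e : V ≃ₗᵢ[ℝ] V) (ζ : sphere (0 : V) 1) : sphere (0 : V) 1 :=
  ⟨e ζ, by simp⟩

@[simp] lemma coe_sphereMap (e : V ≃ₗᵢ[ℝ] V) (ζ : sphere (0 : V) 1) :
    (sphereMap e ζ : V) = e ζ := rfl

lemma continuous_sphereMap (e : V ≃ₗᵢ[ℝ] V) : Continuous (sphereMap e) := by
  unfold sphereMap
  fun_prop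

open scoped Pointwise in
lemma cone_preimage_sphereMap (e : V ≃ₗᵢ[ℝ] V) (s : Set (sphere (0 : V) 1)) (I : Set ℝ) :
    I • ((↑) '' (sphereMap e ⁻¹' s) : Set V) = e ⁻¹' (I • ((↑) '' s : Set V)) := by
  ext x
  simp only [Set.mem_smul, Set.mem_image, Set.mem_preimage]
  constructor
  · rintro ⟨r, hr, _, ⟨ζ, hζ, rfl⟩, rfl⟩
    exact ⟨r, hr, _, ⟨_, hζ, rfl⟩, by simp⟩
  · rintro ⟨r, hr, _, ⟨ζ, hζ, rfl⟩, hx⟩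
    refine ⟨r, hr, _, ⟨sphereMap e.symm ζ, by simpa [sphereMap] using hζ, rfl⟩, ?_⟩
    rw [coe_sphereMap, ← map_smul, hx, e.symm_apply_apply]

lemma measurePreserving_sphereMap [MeasurableSpace V] [BorelSpace V] {μ : Measure V}
    {e : V ≃ₗᵢ[ℝ] V} (he : MeasurePreserving e μ μ) :
    MeasurePreserving (sphereMap e) μ.toSphere μ.toSphere := by
  have hmeas := (continuous_sphereMap e).measurable
  refine ⟨hmeas, Measure.ext fun s hs => ?_⟩
  rw [Measure.map_apply hmeas hs, μ.toSphere_apply' hs, μ.toSphere_apply' (hmeas hs),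
    cone_preimage_sphereMap]
  exact congr(_ * $(he.measure_preimage_equiv (f := e.toHomeomorph.toMeasurableEquiv) _))

end SphereIsometry

section PlaneRotation

open MvPolynomial

variable {n : ℕ} {j k : Fin n}

/-- The orthogonal projection onto the plane of the `j`-th and `k`-th coordinates, for `j ≠ k`. -/
def planeProj (j k : Fin n) : E n →L[ℝ] E n :=
  (EuclideanSpace.proj j).smulRight (EuclideanSpace.single j 1) +
    (EuclideanSpace.proj k).smulRight (EuclideanSpace.single k 1)

/-- `planeProj` followed by a quarter turn of the plane: the generator of its rotations. -/
def planeTurn (j k : Fin n) : E n →L[ℝ] E n :=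
  (EuclideanSpace.proj j).smulRight (EuclideanSpace.single k 1) -
    (EuclideanSpace.proj k).smulRight (EuclideanSpace.single j 1)

/-- Rotation by the angle `t` in the plane of the `j`-th and `k`-th coordinates, for `j ≠ k`. -/
def planeRot (j k : Fin n) (t : ℝ) : E n →L[ℝ] E n :=
  .id ℝ (E n) + (Real.cos t - 1) • planeProj j k + Real.sin t • planeTurn j k

lemma planeRot_apply_left (h : j ≠ k) (t : ℝ) (x : E n) :
    planeRot j k t x j = Real.cos t * x j - Real.sin t * x k := by
  simp [planeRot, planeProj, planeTurn, h]
  ring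

lemma planeRot_apply_right (h : j ≠ k) (t : ℝ) (x : E n) :
    planeRot j k t x k = Real.sin t * x j + Real.cos t * x k := by
  simp [planeRot, planeProj, planeTurn, h.symm]
  ring

lemma planeRot_apply_of_ne {i : Fin n} (hj : i ≠ j) (hk : i ≠ k) (t : ℝ) (x : E n) :
    planeRot j k t x i = x i := by
  simp [planeRot, planeProj, planeTurn, hj, hk]

lemma norm_planeRot (h : j ≠ k) (t : ℝ) (x : E n) : ‖planeRot j k t x‖ = ‖x‖ := by
  rw [← sq_eq_sq₀ (norm_nonneg _) (norm_nonneg _), EuclideanSpace.real_norm_sq_eq,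
    EuclideanSpace.real_norm_sq_eq, ← sub_eq_zero, ← Finset.sum_sub_distrib,
    Fintype.sum_eq_add j k h, planeRot_apply_left h, planeRot_apply_right h]
  · linear_combination (x j ^ 2 + x k ^ 2) * Real.sin_sq_add_cos_sq t
  · rintro i ⟨hj, hk⟩
    rw [planeRot_apply_of_ne hj hk, sub_self]

/-- Rotation in a coordinate plane as a linear isometry. -/
def planeRotIsometry (h : j ≠ k) (t : ℝ) : E n ≃ₗᵢ[ℝ] E n :=
  (⟨planeRot j k t, norm_planeRot h t⟩ : E n →ₗᵢ[ℝ] E n).toLinearIsometryEquiv rfl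

lemma hasDerivAt_planeRot (j k : Fin n) (t : ℝ) :
    HasDerivAt (planeRot j k) (-Real.sin t • planeProj j k + Real.cos t • planeTurn j k) t :=
  ((((Real.hasDerivAt_cos t).sub_const 1).smul_const (planeProj j k)).const_add _).add
    ((Real.hasDerivAt_sin t).smul_const (planeTurn j k))

lemma hasDerivAt_polyFun_planeRot (h : j ≠ k) (P : MvPolynomial (Fin n) ℂ) (t : ℝ) (x : E n) :
    HasDerivAt (fun s => polyFun P (planeRot j k s x))
      (polyFun (rotDeriv j k P) (planeRot j k t x)) t := by
  convert! (hasFDerivAt_polyFun P (planeRot j k t x)).comp_hasDerivAt t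
    ((hasDerivAt_planeRot j k t).clm_apply (hasDerivAt_const t x)) using 1
  rw [sum_apply, Fintype.sum_eq_add j k h]
  · simp [h, h.symm, rotDeriv_apply, planeProj, planeTurn, planeRot_apply_left h,
      planeRot_apply_right h]
    ring
  · rintro i ⟨hj, hk⟩
    simp [hj, hk, planeProj, planeTurn]

lemma continuous_polyFun_planeRot (j k : Fin n) (P : MvPolynomial (Fin n) ℂ) :
    Continuous fun q : ℝ × sphere (0 : E n) 1 => polyFun P (planeRot j k q.1 q.2) := by
  have hrot : Continuous (planeRot j k) :=
    continuous_iff_continuousAt.2 fun t => (hasDerivAt_planeRot j k t).continuousAt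
  exact (continuous_polyFun P).comp ((hrot.comp continuous_fst).clm_apply (by fun_prop))

end PlaneRotation

section SphereMean

open MvPolynomial

variable {n : ℕ}

instance : IsFiniteMeasure (sphereMeasure n) :=
  ⟨(ENNReal.inv_mul_le_one _).trans_lt ENNReal.one_lt_top⟩

instance [NeZero n] : IsProbabilityMeasure (sphereMeasure n) :=
  ⟨ENNReal.inv_mul_cancel (Measure.measure_univ_ne_zero.2 (Measure.toSphere_ne_zero _))
    (measure_ne_top _ _)⟩

lemma integrable_sphereMeasure {F : Type*} [NormedAddCommGroup F] {f : sphere (0 : E n) 1 → F}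
    (hf : Continuous f) : Integrable f (sphereMeasure n) :=
  hf.integrable_of_hasCompactSupport (HasCompactSupport.of_compactSpace f)

@[fun_prop]
lemma continuous_polyFun_sphere (P : MvPolynomial (Fin n) ℂ) :
    Continuous fun ζ : sphere (0 : E n) 1 => polyFun P ζ :=
  (continuous_polyFun P).comp continuous_subtype_val

/-- The mean of a polynomial over the unit sphere. -/
def sphereMean : MvPolynomial (Fin n) ℂ →ₗ[ℂ] ℂ where
  toFun P := ∫ ζ : sphere (0 : E n) 1, polyFun P ζ ∂(sphereMeasure n)
  map_add' P Q := by
    simpa using integral_add (integrable_sphereMeasure (continuous_polyFun_sphere P))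
      (integrable_sphereMeasure (continuous_polyFun_sphere Q))
  map_smul' c P := by simpa using integral_const_mul c _

lemma sphereMean_apply (P : MvPolynomial (Fin n) ℂ) :
    sphereMean P = ∫ ζ : sphere (0 : E n) 1, polyFun P ζ ∂(sphereMeasure n) := rfl

lemma sphereMean_psum_two_mul (P : MvPolynomial (Fin n) ℂ) :
    sphereMean (psum (Fin n) ℂ 2 * P) = sphereMean P := by
  simp [sphereMean_apply, polyFun_psum_two]

lemma integral_polyFun_isometry (P : MvPolynomial (Fin n) ℂ) (e : E n ≃ₗᵢ[ℝ] E n) :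
    ∫ ζ : sphere (0 : E n) 1, polyFun P (e ζ) ∂(sphereMeasure n) = sphereMean P := by
  have he : MeasurePreserving (sphereMap e) (sphereMeasure n) (sphereMeasure n) :=
    (measurePreserving_sphereMap e.measurePreserving).smul_measure _
  have hP : AEStronglyMeasurable (fun ζ : sphere (0 : E n) 1 => polyFun P ζ)
      ((sphereMeasure n).map (sphereMap e)) :=
    (continuous_polyFun_sphere P).aestronglyMeasurable
  rw [sphereMean_apply, ← he.map_eq, integral_map he.aemeasurable hP, he.map_eq]
  rfl

lemma sphereMean_rotDeriv (j k : Fin n) (P : MvPolynomial (Fin n) ℂ) :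
    sphereMean (rotDeriv j k P) = 0 := by
  obtain rfl | h := eq_or_ne j k
  · simp
  have hcont := continuous_polyFun_planeRot j k (rotDeriv j k P)
  have hmean (t : ℝ) : ∫ ζ : sphere (0 : E n) 1, polyFun (rotDeriv j k P) (planeRot j k t ζ)
      ∂(sphereMeasure n) = sphereMean (rotDeriv j k P) :=
    integral_polyFun_isometry _ (planeRotIsometry h t)
  have horbit (ζ : sphere (0 : E n) 1) : ∫ t in (0 : ℝ)..(2 * Real.pi),
      polyFun (rotDeriv j k P) (planeRot j k t ζ) = 0 := by
    rw [intervalIntegral.integral_eq_sub_of_hasDerivAt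
      (fun t _ => hasDerivAt_polyFun_planeRot h P t ζ)
      ((hcont.comp (Continuous.prodMk_left ζ)).intervalIntegrable _ _)]
    simp [planeRot]
  have hint : IntegrableOn (fun q : ℝ × sphere (0 : E n) 1 =>
      polyFun (rotDeriv j k P) (planeRot j k q.1 q.2)) (Set.uIcc 0 (2 * Real.pi) ×ˢ Set.univ)
      (volume.prod (sphereMeasure n)) :=
    hcont.continuousOn.integrableOn_compact (isCompact_uIcc.prod isCompact_univ)
  have hswap := intervalIntegral_integral_swap (μ := sphereMeasure n) (a := 0) (b := 2 * Real.pi)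
    (f := fun t (ζ : sphere (0 : E n) 1) => polyFun (rotDeriv j k P) (planeRot j k t ζ)) <| by
      rw [← (sphereMeasure n).restrict_univ, Measure.prod_restrict]
      exact hint.mono_set (Set.prod_mono_left Set.uIoc_subset_uIcc)
  simp only [hmean, horbit, intervalIntegral.integral_const, integral_zero, sub_zero] at hswap
  simpa [Real.pi_ne_zero] using hswap

lemma sphereMean_polyLaplacian {P : MvPolynomial (Fin n) ℂ} {p : ℕ} (hP : P.IsHomogeneous p) :
    sphereMean (polyLaplacian P) = p * (p + n - 2) * sphereMean P := by
  have h := congr(sphereMean $(casimir_of_isHomogeneous hP))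
  simp only [casimir_apply, map_sum, sphereMean_rotDeriv, Finset.sum_const_zero, map_sub,
    two_mul (psum (Fin n) ℂ 2 * _), map_add, sphereMean_psum_two_mul, map_smul, smul_eq_mul,
    Fintype.card_fin] at h
  linear_combination -h / 2

end SphereMean

section SphericalInnerProduct

open MvPolynomial

variable {n p q : ℕ} {P Q : MvPolynomial (Fin n) ℂ}

/-- The inner product of `L²` of the unit sphere on polynomials, conjugate-linear in the first
argument. -/
def sphereInner : MvPolynomial (Fin n) ℂ →ₗ⋆[ℂ] MvPolynomial (Fin n) ℂ →ₗ[ℂ] ℂ :=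
  LinearMap.mk₂'ₛₗ (starRingEnd ℂ) (RingHom.id ℂ)
    (fun P Q => sphereMean (map (starRingEnd ℂ) P * Q))
    (fun P P' Q => by rw [map_add, add_mul, map_add])
    (fun c P Q => by rw [smul_eq_C_mul, RingHom.map_mul, map_C, ← smul_eq_C_mul,
      smul_mul_assoc, map_smul])
    (fun P Q Q' => by rw [mul_add, map_add])
    (fun c P Q => by rw [mul_smul_comm, map_smul, RingHom.id_apply])

lemma sphereInner_apply (P Q : MvPolynomial (Fin n) ℂ) :
    sphereInner P Q = sphereMean (map (starRingEnd ℂ) P * Q) := rfl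

/-- The squared norm of a polynomial in `L²` of the unit sphere. -/
def polyNormSq (P : MvPolynomial (Fin n) ℂ) : ℝ :=
  ∫ ζ : sphere (0 : E n) 1, ‖polyFun P ζ‖ ^ 2 ∂(sphereMeasure n)

lemma polyNormSq_nonneg (P : MvPolynomial (Fin n) ℂ) : 0 ≤ polyNormSq P :=
  integral_nonneg fun _ => sq_nonneg _

@[simp] lemma polyNormSq_zero : polyNormSq (0 : MvPolynomial (Fin n) ℂ) = 0 := by
  simp [polyNormSq]

lemma polyNormSq_smul (c : ℂ) (P : MvPolynomial (Fin n) ℂ) :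
    polyNormSq (c • P) = ‖c‖ ^ 2 * polyNormSq P := by
  simp only [polyNormSq, map_smul, Pi.smul_apply, norm_smul, mul_pow, integral_const_mul]

lemma sphereInner_self (P : MvPolynomial (Fin n) ℂ) : sphereInner P P = polyNormSq P := by
  rw [sphereInner_apply, sphereMean_apply, polyNormSq, ← integral_complex_ofReal]
  simp [polyFun_map_conj, Complex.conj_mul']

lemma sphereNormSq_polyFun (P : MvPolynomial (Fin n) ℂ) :
    sphereNormSq n (polyFun P) = ENNReal.ofReal (polyNormSq P) := by
  rw [sphereNormSq, polyNormSq, ofReal_integral_eq_lintegral_ofReal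
    (integrable_sphereMeasure (by fun_prop)) (ae_of_all _ fun _ => sq_nonneg _)]
  simp [ENNReal.ofReal_pow]

lemma polyNormSq_le_sq [NeZero n] {M : ℝ} (h : ∀ ζ : sphere (0 : E n) 1, ‖polyFun P ζ‖ ≤ M) :
    polyNormSq P ≤ M ^ 2 :=
  calc polyNormSq P ≤ ∫ _ : sphere (0 : E n) 1, M ^ 2 ∂(sphereMeasure n) :=
        integral_mono (integrable_sphereMeasure (by fun_prop)) (integrable_const _) fun ζ =>
          pow_le_pow_left₀ (norm_nonneg _) (h ζ) 2
    _ = M ^ 2 := by simp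

instance : (sphereMeasure n).IsOpenPosMeasure :=
  Measure.isOpenPosMeasure_smul _ (ENNReal.inv_ne_zero.2 (measure_ne_top _ _))

lemma polyFun_sphere_eq_zero (h : polyNormSq P = 0) (ζ : sphere (0 : E n) 1) :
    polyFun P ζ = 0 := by
  have hcont : Continuous fun ζ : sphere (0 : E n) 1 => ‖polyFun P ζ‖ ^ 2 := by fun_prop
  rw [polyNormSq, integral_eq_zero_iff_of_nonneg (fun _ => sq_nonneg _)
    (integrable_sphereMeasure hcont), hcont.ae_eq_iff_eq _ continuous_zero] at h
  simpa using congrFun h ζ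

lemma eq_zero_of_polyNormSq_eq_zero [NeZero n] (hP : P.IsHomogeneous p)
    (h : polyNormSq P = 0) : P = 0 := by
  refine polyFun_injective ((continuous_polyFun P).ext_on (dense_compl_singleton 0)
    (continuous_polyFun 0) fun x (hx : x ≠ 0) => ?_)
  have hζ : ‖x‖⁻¹ • x ∈ sphere (0 : E n) 1 := by simp [norm_smul, hx]
  rw [← smul_inv_smul₀ (norm_ne_zero_iff.2 hx) x, polyFun_smul_of_isHomogeneous hP,
    polyFun_sphere_eq_zero h ⟨_, hζ⟩]
  simp

lemma sphereInner_rotDeriv_left (j k : Fin n) (P Q : MvPolynomial (Fin n) ℂ) :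
    sphereInner (rotDeriv j k P) Q = -sphereInner P (rotDeriv j k Q) := by
  have h := sphereMean_rotDeriv j k (map (starRingEnd ℂ) P * Q)
  rw [Derivation.leibniz, smul_eq_mul, smul_eq_mul, map_add, ← map_rotDeriv, mul_comm Q] at h
  exact eq_neg_of_add_eq_zero_right h

lemma sphereInner_casimir_left (P Q : MvPolynomial (Fin n) ℂ) :
    sphereInner (casimir P) Q = sphereInner P (casimir Q) := by
  simp only [casimir_apply, map_sum, LinearMap.sum_apply, sphereInner_rotDeriv_left, neg_neg]

lemma sum_polyNormSq_rotDeriv (hP : P ∈ solidHarmonic (Fin n) ℂ p) :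
    ∑ j, ∑ k, polyNormSq (rotDeriv j k P) = 2 * (p * (p + n - 2)) * polyNormSq P := by
  have h : ∑ j, ∑ k, sphereInner (rotDeriv j k P) (rotDeriv j k P) =
      -sphereInner P (casimir P) := by
    simp only [casimir_apply, map_sum, sphereInner_rotDeriv_left, Finset.sum_neg_distrib]
  rw [casimir_of_mem_solidHarmonic hP, map_smul, smul_eq_mul, ← neg_mul, neg_neg,
    Fintype.card_fin] at h
  simp only [sphereInner_self] at h
  exact_mod_cast h

lemma sum_pairIndex_polyNormSq_rotDeriv (hP : P ∈ solidHarmonic (Fin n) ℂ p) :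
    ∑ a : PairIndex n, polyNormSq (rotDeriv a.1.1 a.1.2 P) =
      2 * (p * (p + n - 2)) * polyNormSq P := by
  rw [← sum_polyNormSq_rotDeriv hP, ← Fintype.sum_prod_type', ← Finset.sum_subtype
    (Finset.univ.filter fun a : Fin n × Fin n => a.1 ≠ a.2) (by simp)
    (fun a : Fin n × Fin n => polyNormSq (rotDeriv a.1 a.2 P)), Finset.sum_filter_of_ne]
  rintro ⟨j, k⟩ - h (rfl : j = k)
  exact h (by simp)

/-- Taking the mean of `Δ(P̄ P) = 2 ∑ₖ |∂ₖ P|²`, as `P` and `P̄` are harmonic. -/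
lemma sum_polyNormSq_pderiv (hP : P ∈ solidHarmonic (Fin n) ℂ p) :
    ∑ k, polyNormSq (pderiv k P) = p * (2 * p + n - 2) * polyNormSq P := by
  have hP' := mem_solidHarmonic.1 (map_mem_solidHarmonic hP (starRingEnd ℂ))
  rw [mem_solidHarmonic] at hP
  have h := sphereMean_polyLaplacian (hP'.1.mul hP.1)
  rw [polyLaplacian_mul, hP.2, hP'.2, zero_mul, mul_zero, zero_add, add_zero, two_mul, map_add,
    map_sum, ← sphereInner_apply] at h
  simp only [pderiv_map, ← sphereInner_apply, sphereInner_self] at h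
  have h' : ∑ k, (polyNormSq (pderiv k P) : ℂ) = p * (2 * p + n - 2) * polyNormSq P := by
    push_cast at h
    linear_combination h / 2
  exact_mod_cast h'

variable [n.AtLeastTwo]

/-- The degrees are told apart by the eigenvalues of the symmetric operator `casimir`. -/
lemma sphereInner_eq_zero_of_ne (hP : P ∈ solidHarmonic (Fin n) ℂ p)
    (hQ : Q ∈ solidHarmonic (Fin n) ℂ q) (hpq : p ≠ q) : sphereInner P Q = 0 := by
  have h := sphereInner_casimir_left P Q
  rw [casimir_of_mem_solidHarmonic hP, casimir_of_mem_solidHarmonic hQ,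
    LinearMap.map_smulₛₗ₂, map_smul, smul_eq_mul, smul_eq_mul, ← sub_eq_zero, ← sub_mul] at h
  refine (mul_eq_zero.1 h).resolve_left fun h => ?_
  obtain ⟨d, rfl⟩ := Nat.exists_eq_add_of_le' (Nat.AtLeastTwo.prop (n := n))
  have hprod : ((q : ℂ) - p) * ((q + p + d : ℕ) : ℂ) = 0 := by
    simp only [map_neg, map_mul, map_ofNat, map_sub, map_add, map_natCast, Fintype.card_fin] at h
    push_cast at h ⊢
    linear_combination h / 2
  rcases mul_eq_zero.1 hprod with hdiff | hsum
  · exact hpq (by exact_mod_cast (sub_eq_zero.1 hdiff).symm)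
  · have : q + p + d = 0 := by exact_mod_cast hsum
    omega

lemma polyNormSq_sum {P : ℕ → MvPolynomial (Fin n) ℂ} (hP : ∀ p, P p ∈ solidHarmonic (Fin n) ℂ p)
    (s : Finset ℕ) : polyNormSq (∑ p ∈ s, P p) = ∑ p ∈ s, polyNormSq (P p) := by
  have h : sphereInner (∑ p ∈ s, P p) (∑ p ∈ s, P p) = ∑ p ∈ s, sphereInner (P p) (P p) := by
    rw [map_sum sphereInner, LinearMap.sum_apply]
    refine Finset.sum_congr rfl fun p hp => ?_
    rw [map_sum, Finset.sum_eq_single_of_mem p hp fun q _ hq =>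
      sphereInner_eq_zero_of_ne (hP p) (hP q) hq.symm]
  simp only [sphereInner_self] at h
  exact_mod_cast h

end SphericalInnerProduct

section PolarCoordinates

variable {V : Type*} [NormedAddCommGroup V] [NormedSpace ℝ V] [FiniteDimensional ℝ V]
  [MeasurableSpace V] [BorelSpace V] [Nontrivial V] (μ : Measure V) [μ.IsAddHaarMeasure]
  {g : V → ℝ≥0∞}

lemma lintegral_eq_lintegral_Ioi_lintegral_toSphere (hg : Measurable g) :
    ∫⁻ x, g x ∂μ = ∫⁻ r in Set.Ioi (0 : ℝ), ENNReal.ofReal (r ^ (Module.finrank ℝ V - 1)) *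
      ∫⁻ ζ : sphere (0 : V) 1, g (r • (ζ : V)) ∂μ.toSphere := by
  have hpolar : Measurable fun q : sphere (0 : V) 1 × Set.Ioi (0 : ℝ) =>
      g ((q.2 : ℝ) • (q.1 : V)) := hg.comp (by fun_prop)
  have hsphere : Measurable fun r : Set.Ioi (0 : ℝ) =>
      ∫⁻ ζ : sphere (0 : V) 1, g ((r : ℝ) • (ζ : V)) ∂μ.toSphere :=
    hpolar.lintegral_prod_left'
  have hchange := μ.measurePreserving_homeomorphUnitSphereProd.lintegral_comp hpolar
  have hinv (x : ({0}ᶜ : Set V)) : ((homeomorphUnitSphereProd V x).2 : ℝ) •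
      ((homeomorphUnitSphereProd V x).1 : V) = x := by
    simp [smul_smul, norm_ne_zero_iff.2 x.2]
  simp only [hinv] at hchange
  rw [lintegral_subtype_comap (measurableSet_singleton _).compl, restrict_compl_singleton,
    lintegral_prod_symm _ hpolar.aemeasurable, Measure.volumeIoiPow,
    lintegral_withDensity_eq_lintegral_mul _ (by fun_prop) hsphere] at hchange
  exact hchange.trans (lintegral_subtype_comap measurableSet_Ioi fun r : ℝ =>
    ENNReal.ofReal (r ^ (Module.finrank ℝ V - 1)) *
      ∫⁻ ζ : sphere (0 : V) 1, g (r • (ζ : V)) ∂μ.toSphere)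

lemma setLIntegral_ball_eq_lintegral_Ioo_lintegral_toSphere (hg : Measurable g) (R : ℝ) :
    ∫⁻ x in ball (0 : V) R, g x ∂μ =
      ∫⁻ r in Set.Ioo (0 : ℝ) R, ENNReal.ofReal (r ^ (Module.finrank ℝ V - 1)) *
        ∫⁻ ζ : sphere (0 : V) 1, g (r • (ζ : V)) ∂μ.toSphere := by
  rw [← lintegral_indicator measurableSet_ball,
    lintegral_eq_lintegral_Ioi_lintegral_toSphere μ (hg.indicator measurableSet_ball),
    ← Set.Iio_inter_Ioi, ← Measure.restrict_restrict measurableSet_Iio,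
    ← lintegral_indicator measurableSet_Iio]
  refine setLIntegral_congr_fun measurableSet_Ioi fun r (hr : 0 < r) => ?_
  by_cases h : r < R <;> simp [Set.indicator, h, norm_smul, abs_of_pos hr]

lemma setLIntegral_ball_mono {f : V → ℝ≥0∞} (hf : Measurable f) (hg : Measurable g) {R : ℝ}
    (h : ∀ r ∈ Set.Ioo 0 R, ∫⁻ ζ : sphere (0 : V) 1, f (r • (ζ : V)) ∂μ.toSphere ≤
      ∫⁻ ζ : sphere (0 : V) 1, g (r • (ζ : V)) ∂μ.toSphere) :
    ∫⁻ x in ball (0 : V) R, f x ∂μ ≤ ∫⁻ x in ball (0 : V) R, g x ∂μ := by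
  simp only [setLIntegral_ball_eq_lintegral_Ioo_lintegral_toSphere μ hf,
    setLIntegral_ball_eq_lintegral_Ioo_lintegral_toSphere μ hg]
  exact setLIntegral_mono' measurableSet_Ioo fun r hr => by gcongr 1; exact h r hr

end PolarCoordinates

section MeanValue

open MvPolynomial

section AffineSubst

variable {σ R : Type*} [CommRing R]

/-- The substitution `P(y) ↦ P(x + t y)`. -/
def affineSubst (x : σ → R) (t : R) : MvPolynomial σ R →ₐ[R] MvPolynomial σ R :=
  bind₁ fun i => C (x i) + C t * X i

lemma eval_affineSubst (x y : σ → R) (t : R) (P : MvPolynomial σ R) :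
    eval y (affineSubst x t P) = eval (x + t • y) P := by
  simp only [affineSubst, eval, eval₂Hom_bind₁]
  congr
  ext i
  simp

lemma pderiv_affineSubst (x : σ → R) (t : R) (P : MvPolynomial σ R) (k : σ) :
    pderiv k (affineSubst x t P) = C t * affineSubst x t (pderiv k P) := by
  classical
  induction P using MvPolynomial.induction_on with
  | C a => simp [affineSubst]
  | add P Q hP hQ => simp only [map_add, hP, hQ, mul_add]
  | mul_X P i hP =>
    have hX : pderiv k (affineSubst x t (X i : MvPolynomial σ R)) =
        C t * affineSubst x t (pderiv k (X i)) := by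
      obtain rfl | h := eq_or_ne k i
      · simp [affineSubst]
      · simp [affineSubst, pderiv_X_of_ne h.symm]
    simp only [map_mul, map_add, Derivation.leibniz, hP, hX, smul_eq_mul]
    ring

lemma polyLaplacian_affineSubst [Fintype σ] (x : σ → R) (t : R) (P : MvPolynomial σ R) :
    polyLaplacian (affineSubst x t P) = C (t ^ 2) * affineSubst x t (polyLaplacian P) := by
  simp only [polyLaplacian_apply, pderiv_affineSubst, pderiv_C_mul, map_sum, Finset.mul_sum,
    ← mul_assoc, ← map_mul, sq]

end AffineSubst

variable {n p : ℕ} {P : MvPolynomial (Fin n) ℂ}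

lemma polyFun_affineSubst (P : MvPolynomial (Fin n) ℂ) (x : E n) (t : ℝ) (y : E n) :
    polyFun (affineSubst (fun i => (x i : ℂ)) t P) y = polyFun P (x + t • y) := by
  rw [polyFun_apply, polyFun_apply, eval_affineSubst]
  congr 2
  ext i
  simp

lemma toSphere_eq_smul_sphereMeasure [NeZero n] :
    (volume : Measure (E n)).toSphere =
      (volume : Measure (E n)).toSphere Set.univ • sphereMeasure n := by
  rw [sphereMeasure, smul_smul, ENNReal.mul_inv_cancel
    (Measure.measure_univ_ne_zero.2 (Measure.toSphere_ne_zero _)) (measure_ne_top _ _), one_smul]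

lemma setLIntegral_ball_enorm_polyFun_sq_le [NeZero n] (hP : P.IsHomogeneous p) (R : ℝ) :
    ∫⁻ y in ball (0 : E n) R, ‖polyFun P y‖ₑ ^ 2 ≤
      ENNReal.ofReal (R ^ (2 * p) * polyNormSq P) * volume (ball (0 : E n) R) := by
  have hmeas : Measurable fun y => ‖polyFun P y‖ₑ ^ 2 :=
    (continuous_polyFun P).measurable.enorm.pow_const 2
  rw [← setLIntegral_const]
  refine setLIntegral_ball_mono _ hmeas measurable_const fun r ⟨hr0, hrR⟩ => ?_
  rw [toSphere_eq_smul_sphereMeasure, lintegral_smul_measure, lintegral_smul_measure]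
  gcongr 1
  have henorm : ‖(r : ℂ) ^ p‖ₑ ^ 2 = ENNReal.ofReal (r ^ (2 * p)) := by
    rw [← ofReal_norm, ← ENNReal.ofReal_pow (norm_nonneg _), norm_pow, Complex.norm_real,
      Real.norm_of_nonneg hr0.le, ← pow_mul, mul_comm]
  simp only [polyFun_smul_of_isHomogeneous hP, enorm_mul, mul_pow, henorm, lintegral_const,
    measure_univ, mul_one]
  rw [lintegral_const_mul' _ _ ENNReal.ofReal_ne_top, ← sphereNormSq, sphereNormSq_polyFun,
    ← ENNReal.ofReal_mul (by positivity)]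
  have := polyNormSq_nonneg P
  gcongr

variable [n.AtLeastTwo]

lemma norm_polyFun_zero_sq_le (hP : polyLaplacian P = 0) : ‖polyFun P 0‖ ^ 2 ≤ polyNormSq P := by
  have hconst : polyNormSq (homogeneousComponent 0 P) = ‖polyFun P 0‖ ^ 2 := by
    have hzero : polyFun P 0 = coeff 0 P := by
      simp only [polyFun_apply, PiLp.zero_apply, Complex.ofReal_zero]
      exact DFunLike.congr_fun eval_zero P
    simp [polyNormSq, homogeneousComponent_zero, hzero]
  rw [← hconst]
  conv_rhs => rw [← sum_homogeneousComponent P,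
    polyNormSq_sum (homogeneousComponent_mem_solidHarmonic hP)]
  exact Finset.single_le_sum (f := fun p => polyNormSq (homogeneousComponent p P))
    (fun _ _ => polyNormSq_nonneg _) (by simp)

lemma enorm_polyFun_sq_le_lintegral (hP : polyLaplacian P = 0) (x : E n) (t : ℝ) :
    ‖polyFun P x‖ₑ ^ 2 ≤
      ∫⁻ ζ : sphere (0 : E n) 1, ‖polyFun P (x + t • (ζ : E n))‖ₑ ^ 2 ∂(sphereMeasure n) := by
  set Q := affineSubst (fun i => (x i : ℂ)) t P with hQdef
  have hQ : polyLaplacian Q = 0 := by rw [polyLaplacian_affineSubst, hP, map_zero, mul_zero]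
  have h := ENNReal.ofReal_le_ofReal (norm_polyFun_zero_sq_le hQ)
  rw [← sphereNormSq_polyFun, sphereNormSq, ENNReal.ofReal_pow (norm_nonneg _), ofReal_norm] at h
  simpa only [hQdef, polyFun_affineSubst, smul_zero, add_zero] using h

lemma enorm_polyFun_sq_mul_volume_ball_le (hP : polyLaplacian P = 0) (x : E n) (δ : ℝ) :
    ‖polyFun P x‖ₑ ^ 2 * volume (ball (0 : E n) δ) ≤ ∫⁻ y in ball x δ, ‖polyFun P y‖ₑ ^ 2 := by
  have hmeas : Measurable fun y => ‖polyFun P y‖ₑ ^ 2 :=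
    (continuous_polyFun P).measurable.enorm.pow_const 2
  calc ‖polyFun P x‖ₑ ^ 2 * volume (ball (0 : E n) δ)
      = ∫⁻ _ in ball (0 : E n) δ, ‖polyFun P x‖ₑ ^ 2 := (setLIntegral_const _ _).symm
    _ ≤ ∫⁻ y in ball (0 : E n) δ, ‖polyFun P (x + y)‖ₑ ^ 2 := by
        refine setLIntegral_ball_mono _ measurable_const (hmeas.comp (by fun_prop)) fun r _ => ?_
        rw [toSphere_eq_smul_sphereMeasure, lintegral_smul_measure, lintegral_smul_measure]
        gcongr 1
        simpa using enorm_polyFun_sq_le_lintegral hP x r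
    _ = ∫⁻ y in ball x δ, ‖polyFun P y‖ₑ ^ 2 := by
        rw [← (measurePreserving_add_left volume x).setLIntegral_comp_preimage measurableSet_ball
          hmeas, preimage_add_ball, sub_self]

lemma norm_polyFun_sq_mul_le (hP : P ∈ solidHarmonic (Fin n) ℂ p) {x : E n} {R : ℝ}
    (hx : ‖x‖ < R) :
    ‖polyFun P x‖ ^ 2 * (R - ‖x‖) ^ n ≤ R ^ (2 * p) * polyNormSq P * R ^ n := by
  have hR : 0 < R := (norm_nonneg x).trans_lt hx
  have hball : ball x (R - ‖x‖) ⊆ ball 0 R :=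
    ball_subset_ball' (by rw [dist_zero_right, sub_add_cancel])
  have hmean := (enorm_polyFun_sq_mul_volume_ball_le (mem_solidHarmonic.1 hP).2 x _).trans <|
    (lintegral_mono_set hball).trans
      (setLIntegral_ball_enorm_polyFun_sq_le (mem_solidHarmonic.1 hP).1 R)
  rw [Measure.addHaar_ball_of_pos _ _ (sub_pos.2 hx), Measure.addHaar_ball_of_pos _ _ hR,
    ← mul_assoc, ← mul_assoc, ENNReal.mul_le_mul_iff_left (measure_ball_pos _ _ one_pos).ne'
    measure_ball_lt_top.ne, finrank_euclideanSpace, Fintype.card_fin, ← ofReal_norm,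
    ← ENNReal.ofReal_pow (norm_nonneg _), ← ENNReal.ofReal_mul (by positivity),
    ← ENNReal.ofReal_mul (by have := polyNormSq_nonneg P; positivity)] at hmean
  exact (ENNReal.ofReal_le_ofReal_iff (by have := polyNormSq_nonneg P; positivity)).1 hmean

lemma exists_norm_polyFun_le {r R : ℝ} (hrR : r < R) : ∃ K : ℝ, 0 ≤ K ∧
    ∀ p, ∀ P ∈ solidHarmonic (Fin n) ℂ p, ∀ x : E n, ‖x‖ ≤ r →
      ‖polyFun P x‖ ≤ K * (R ^ p * √(polyNormSq P)) := by
  refine ⟨√(R ^ n / (R - r) ^ n), Real.sqrt_nonneg _, fun p P hP x hx => ?_⟩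
  have hR : 0 < R := (norm_nonneg x).trans_lt (hx.trans_lt hrR)
  have : 0 < R - r := sub_pos.2 hrR
  have hsq : ‖polyFun P x‖ ^ 2 ≤ R ^ n / (R - r) ^ n * ((R ^ p) ^ 2 * polyNormSq P) := by
    rw [div_mul_eq_mul_div, le_div_iff₀ (by positivity)]
    calc ‖polyFun P x‖ ^ 2 * (R - r) ^ n ≤ ‖polyFun P x‖ ^ 2 * (R - ‖x‖) ^ n := by gcongr
      _ ≤ R ^ (2 * p) * polyNormSq P * R ^ n := norm_polyFun_sq_mul_le hP (hx.trans_lt hrR)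
      _ = _ := by ring
  calc ‖polyFun P x‖ ≤ √(R ^ n / (R - r) ^ n * ((R ^ p) ^ 2 * polyNormSq P)) :=
        Real.le_sqrt_of_sq_le hsq
    _ = _ := by
        rw [Real.sqrt_mul (by positivity), Real.sqrt_mul (by positivity),
          Real.sqrt_sq (by positivity)]

end MeanValue

section DerivativeBounds

open MvPolynomial

variable {n p : ℕ} {P : MvPolynomial (Fin n) ℂ}

lemma summable_nat_mul_pow_mul {a : ℕ → ℝ} (ha : ∀ p, 0 ≤ a p)
    (h : ∀ s ∈ Set.Ioo (0 : ℝ) 1, Summable fun p => s ^ p * a p) {s : ℝ}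
    (hs : s ∈ Set.Ioo (0 : ℝ) 1) : Summable fun p : ℕ => p * s ^ p * a p := by
  obtain ⟨hs0, hs1⟩ := hs
  obtain ⟨t, hst, ht1⟩ := exists_between hs1
  have ht0 : 0 < t := hs0.trans hst
  obtain ⟨C, hC⟩ := (tendsto_self_mul_const_pow_of_lt_one (r := s / t) (by positivity)
    ((div_lt_one ht0).2 hst)).bddAbove_range
  refine ((h t ⟨ht0, ht1⟩).mul_left C).of_nonneg_of_le
    (fun p => mul_nonneg (by positivity) (ha p)) fun p => ?_
  calc p * s ^ p * a p = p * (s / t) ^ p * (t ^ p * a p) := by rw [div_pow]; field_simp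
    _ ≤ C * (t ^ p * a p) :=
        mul_le_mul_of_nonneg_right (hC ⟨p, rfl⟩) (mul_nonneg (by positivity) (ha p))

lemma sqrt_polyNormSq_rotDeriv_le [NeZero n] (hP : P ∈ solidHarmonic (Fin n) ℂ p) (j k : Fin n) :
    √(polyNormSq (rotDeriv j k P)) ≤ 2 * n * p * √(polyNormSq P) := by
  have hn : (1 : ℝ) ≤ n := mod_cast NeZero.one_le
  rw [← Real.sqrt_sq (by positivity : (0 : ℝ) ≤ 2 * n * p), ← Real.sqrt_mul (by positivity)]
  refine Real.sqrt_le_sqrt ?_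
  calc polyNormSq (rotDeriv j k P) ≤ ∑ j, ∑ k, polyNormSq (rotDeriv j k P) :=
        (Finset.single_le_sum (f := fun k => polyNormSq (rotDeriv j k P))
          (fun _ _ => polyNormSq_nonneg _) (Finset.mem_univ k)).trans <|
        Finset.single_le_sum (f := fun j => ∑ k, polyNormSq (rotDeriv j k P))
          (fun _ _ => Finset.sum_nonneg fun _ _ => polyNormSq_nonneg _) (Finset.mem_univ j)
    _ = 2 * (p * (p + n - 2)) * polyNormSq P := sum_polyNormSq_rotDeriv hP
    _ ≤ (2 * n * p) ^ 2 * polyNormSq P := by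
        refine mul_le_mul_of_nonneg_right ?_ (polyNormSq_nonneg P)
        obtain rfl | hp := p.eq_zero_or_pos
        · simp
        · have hp : (1 : ℝ) ≤ p := mod_cast hp
          nlinarith [mul_nonneg (sub_nonneg.2 hn) (sub_nonneg.2 hp),
            mul_pos (zero_lt_one.trans_le hn) (zero_lt_one.trans_le hp)]

lemma sqrt_polyNormSq_pderiv_le [NeZero n] (hP : P ∈ solidHarmonic (Fin n) ℂ p) (k : Fin n) :
    √(polyNormSq (pderiv k P)) ≤ 2 * n * p * √(polyNormSq P) := by
  have hn : (1 : ℝ) ≤ n := mod_cast NeZero.one_le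
  rw [← Real.sqrt_sq (by positivity : (0 : ℝ) ≤ 2 * n * p), ← Real.sqrt_mul (by positivity)]
  refine Real.sqrt_le_sqrt ?_
  calc polyNormSq (pderiv k P) ≤ ∑ k, polyNormSq (pderiv k P) :=
        Finset.single_le_sum (f := fun k => polyNormSq (pderiv k P))
          (fun _ _ => polyNormSq_nonneg _) (Finset.mem_univ k)
    _ = p * (2 * p + n - 2) * polyNormSq P := sum_polyNormSq_pderiv hP
    _ ≤ (2 * n * p) ^ 2 * polyNormSq P := by
        refine mul_le_mul_of_nonneg_right ?_ (polyNormSq_nonneg P)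
        obtain rfl | hp := p.eq_zero_or_pos
        · simp
        · have hp : (1 : ℝ) ≤ p := mod_cast hp
          nlinarith [mul_nonneg (sub_nonneg.2 hn) (sub_nonneg.2 hp),
            mul_pos (zero_lt_one.trans_le hn) (zero_lt_one.trans_le hp)]

lemma norm_fderiv_polyFun_le (P : MvPolynomial (Fin n) ℂ) (x : E n) :
    ‖fderiv ℝ (polyFun P) x‖ ≤ ∑ k, ‖polyFun (pderiv k P) x‖ := by
  rw [(hasFDerivAt_polyFun P x).fderiv]
  refine (norm_sum_le _ _).trans (Finset.sum_le_sum fun k _ => ?_)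
  rw [ContinuousLinearMap.norm_smulRight_apply]
  refine mul_le_of_le_one_left (norm_nonneg _) (ContinuousLinearMap.opNorm_le_bound _ zero_le_one
    fun v => ?_)
  simpa using PiLp.norm_apply_le v k

lemma exists_norm_fderiv_polyFun_le [n.AtLeastTwo] {r R : ℝ} (hR : 0 < R) (hrR : r < R) :
    ∃ K : ℝ, ∀ p, ∀ P ∈ solidHarmonic (Fin n) ℂ p, ∀ x : E n, ‖x‖ ≤ r →
      ‖fderiv ℝ (polyFun P) x‖ ≤ K * (p * R ^ p * √(polyNormSq P)) := by
  obtain ⟨K, hK, hbound⟩ := exists_norm_polyFun_le (n := n) hrR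
  refine ⟨n * (K * (2 * n * R⁻¹)), fun p P hP x hx => ?_⟩
  have hpderiv (k : Fin n) :
      ‖polyFun (pderiv k P) x‖ ≤ K * (2 * n * R⁻¹) * (p * R ^ p * √(polyNormSq P)) :=
    calc ‖polyFun (pderiv k P) x‖ ≤ K * (R ^ (p - 1) * √(polyNormSq (pderiv k P))) :=
          hbound _ _ (pderiv_mem_solidHarmonic hP k) x hx
      _ ≤ K * (R ^ (p - 1) * (2 * n * p * √(polyNormSq P))) := by
          gcongr
          exact sqrt_polyNormSq_pderiv_le hP k
      _ = K * (2 * n * R⁻¹) * (p * R ^ p * √(polyNormSq P)) := by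
          obtain _ | p := p
          · simp
          · rw [Nat.add_sub_cancel, pow_succ]
            field_simp
  calc ‖fderiv ℝ (polyFun P) x‖ ≤ ∑ k, ‖polyFun (pderiv k P) x‖ := norm_fderiv_polyFun_le P x
    _ ≤ ∑ _ : Fin n, K * (2 * n * R⁻¹) * (p * R ^ p * √(polyNormSq P)) :=
        Finset.sum_le_sum fun k _ => hpderiv k
    _ = n * (K * (2 * n * R⁻¹)) * (p * R ^ p * √(polyNormSq P)) := by simp [mul_assoc]

end DerivativeBounds

section HarmonicSeries

open MvPolynomial

variable {n : ℕ} {P : ℕ → MvPolynomial (Fin n) ℂ}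

/-- The sequences of solid harmonics, one in each degree, whose `L²` norms on the sphere grow slowly
enough for the sum to converge, with all its derivatives, locally uniformly on the unit ball. -/
structure IsHarmonicSeries (P : ℕ → MvPolynomial (Fin n) ℂ) : Prop where
  solid : ∀ p, P p ∈ solidHarmonic (Fin n) ℂ p
  summable : ∀ s ∈ Set.Ioo (0 : ℝ) 1, Summable fun p => s ^ p * √(polyNormSq (P p))

/-- The sum of a series of polynomials, as a function; it is meaningful for an `IsHarmonicSeries`
inside the unit ball. -/
def seriesSum (P : ℕ → MvPolynomial (Fin n) ℂ) (x : E n) : ℂ := ∑' p, polyFun (P p) x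

/-- The formal counterpart of `iteratedTangential`. -/
def iteratedRotDeriv {m : ℕ} (J : Fin m → PairIndex n) (P : MvPolynomial (Fin n) ℂ) :
    MvPolynomial (Fin n) ℂ :=
  (List.ofFn J).foldr (fun a => rotDeriv a.1.1 a.1.2) P

lemma iteratedRotDeriv_zero (J : Fin 0 → PairIndex n) (P : MvPolynomial (Fin n) ℂ) :
    iteratedRotDeriv J P = P := rfl

lemma iteratedRotDeriv_succ {m : ℕ} (J : Fin (m + 1) → PairIndex n) (P : MvPolynomial (Fin n) ℂ) :
    iteratedRotDeriv J P = rotDeriv (J 0).1.1 (J 0).1.2 (iteratedRotDeriv (Fin.tail J) P) := by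
  rw [iteratedRotDeriv, List.ofFn_succ]
  rfl

lemma iteratedTangential_succ {m : ℕ} (J : Fin (m + 1) → PairIndex n) (f : E n → ℂ) :
    iteratedTangential n (m + 1) J f =
      tangential n (J 0) (iteratedTangential n m (Fin.tail J) f) := by
  rw [iteratedTangential, List.ofFn_succ]
  rfl

lemma eqOn_tangential {f g : E n → ℂ} {U : Set (E n)} (hU : IsOpen U) (h : Set.EqOn f g U)
    (a : PairIndex n) : Set.EqOn (tangential n a f) (tangential n a g) U := fun x hx => by
  simp only [tangential, partialDeriv, (h.eventuallyEq_of_mem (hU.mem_nhds hx)).fderiv_eq]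

namespace IsHarmonicSeries

protected lemma rotDeriv [NeZero n] (hP : IsHarmonicSeries P) (j k : Fin n) :
    IsHarmonicSeries fun p => rotDeriv j k (P p) where
  solid p := rotDeriv_mem_solidHarmonic (hP.solid p) j k
  summable s hs := by
    have hsum := summable_nat_mul_pow_mul (fun _ => Real.sqrt_nonneg _) hP.summable hs
    refine (hsum.mul_left (2 * n : ℝ)).of_nonneg_of_le
      (fun p => mul_nonneg (pow_nonneg hs.1.le p) (Real.sqrt_nonneg _)) fun p => ?_
    calc _ ≤ s ^ p * (2 * n * p * √(polyNormSq (P p))) :=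
          mul_le_mul_of_nonneg_left (sqrt_polyNormSq_rotDeriv_le (hP.solid p) j k)
            (pow_nonneg hs.1.le p)
      _ = _ := by ring

protected lemma iteratedRotDeriv [NeZero n] (hP : IsHarmonicSeries P) {m : ℕ}
    (J : Fin m → PairIndex n) :
    IsHarmonicSeries fun p => iteratedRotDeriv J (P p) := by
  induction m with
  | zero => exact hP
  | succ m ih =>
    simp only [iteratedRotDeriv_succ]
    exact (ih (Fin.tail J)).rotDeriv _ _

variable [n.AtLeastTwo]

lemma exists_summable_norm_polyFun_le (hP : IsHarmonicSeries P) {r : ℝ} (hr : r < 1) :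
    ∃ u : ℕ → ℝ, Summable u ∧ ∀ p, ∀ x : E n, ‖x‖ ≤ r → ‖polyFun (P p) x‖ ≤ u p := by
  obtain ⟨s, hrs, hs1⟩ := exists_between (max_lt hr one_pos)
  obtain ⟨hrs, hs0⟩ := max_lt_iff.1 hrs
  obtain ⟨K, -, hbound⟩ := exists_norm_polyFun_le (n := n) hrs
  exact ⟨_, (hP.summable s ⟨hs0, hs1⟩).mul_left K, fun p x hx => hbound p _ (hP.solid p) x hx⟩

lemma exists_summable_norm_fderiv_polyFun_le (hP : IsHarmonicSeries P) {r : ℝ} (hr : r < 1) :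
    ∃ u : ℕ → ℝ, Summable u ∧ ∀ p, ∀ x : E n, ‖x‖ ≤ r → ‖fderiv ℝ (polyFun (P p)) x‖ ≤ u p := by
  obtain ⟨s, hrs, hs1⟩ := exists_between (max_lt hr one_pos)
  obtain ⟨hrs, hs0⟩ := max_lt_iff.1 hrs
  obtain ⟨K, hbound⟩ := exists_norm_fderiv_polyFun_le (n := n) hs0 hrs
  exact ⟨_, (summable_nat_mul_pow_mul (fun _ => Real.sqrt_nonneg _) hP.summable
    ⟨hs0, hs1⟩).mul_left K, fun p x hx => hbound p _ (hP.solid p) x hx⟩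

lemma hasSum (hP : IsHarmonicSeries P) {x : E n} (hx : ‖x‖ < 1) :
    HasSum (fun p => polyFun (P p) x) (seriesSum P x) := by
  obtain ⟨u, hu, hbound⟩ := hP.exists_summable_norm_polyFun_le hx
  exact (Summable.of_norm_bounded hu fun p => hbound p x le_rfl).hasSum

lemma summable_fderiv (hP : IsHarmonicSeries P) {x : E n} (hx : ‖x‖ < 1) :
    Summable fun p => fderiv ℝ (polyFun (P p)) x := by
  obtain ⟨u, hu, hbound⟩ := hP.exists_summable_norm_fderiv_polyFun_le hx
  exact .of_norm_bounded hu fun p => hbound p x le_rfl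

lemma hasFDerivAt (hP : IsHarmonicSeries P) {x : E n} (hx : ‖x‖ < 1) :
    HasFDerivAt (seriesSum P) (∑' p, fderiv ℝ (polyFun (P p)) x) x := by
  obtain ⟨r, hxr, hr⟩ := exists_between hx
  obtain ⟨u, hu, hbound⟩ := hP.exists_summable_norm_fderiv_polyFun_le hr
  have hxr : x ∈ ball (0 : E n) r := mem_ball_zero_iff.2 hxr
  exact hasFDerivAt_tsum_of_isPreconnected hu isOpen_ball (convex_ball _ _).isPreconnected
    (fun p y _ => (hasFDerivAt_polyFun (P p) y).differentiableAt.hasFDerivAt)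
    (fun p y hy => hbound p y (mem_ball_zero_iff.1 hy).le) hxr (hP.hasSum hx).summable hxr

lemma continuousOn (hP : IsHarmonicSeries P) : ContinuousOn (seriesSum P) (ball 0 1) := fun _ hx =>
  (hP.hasFDerivAt (mem_ball_zero_iff.1 hx)).continuousAt.continuousWithinAt

lemma eqOn_tangential_seriesSum (hP : IsHarmonicSeries P) (a : PairIndex n) :
    Set.EqOn (tangential n a (seriesSum P))
      (seriesSum fun p => rotDeriv a.1.1 a.1.2 (P p)) (ball 0 1) := by
  intro x hx
  rw [mem_ball_zero_iff] at hx
  have hpartial (v : E n) :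
      HasSum (fun p => fderiv ℝ (polyFun (P p)) x v) (fderiv ℝ (seriesSum P) x v) := by
    rw [(hP.hasFDerivAt hx).fderiv]
    exact (ContinuousLinearMap.apply ℝ ℂ v).hasSum (hP.summable_fderiv hx).hasSum
  simp only [seriesSum, ← tangential_polyFun]
  exact (((hpartial _).mul_left _).sub ((hpartial _).mul_left _)).tsum_eq.symm

lemma eqOn_iteratedTangential (hP : IsHarmonicSeries P) {f : E n → ℂ}
    (hf : Set.EqOn f (seriesSum P) (ball 0 1)) {m : ℕ} (J : Fin m → PairIndex n) :
    Set.EqOn (iteratedTangential n m J f)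
      (seriesSum fun p => iteratedRotDeriv J (P p)) (ball 0 1) := by
  induction m with
  | zero => exact hf
  | succ m ih =>
    simp only [iteratedTangential_succ, iteratedRotDeriv_succ]
    exact (eqOn_tangential isOpen_ball (ih (Fin.tail J)) _).trans
      ((hP.iteratedRotDeriv _).eqOn_tangential_seriesSum _)

end IsHarmonicSeries

end HarmonicSeries

section HarmonicExpansion

open MvPolynomial

lemma tendstoLocallyUniformlyOn_ball_iff {X Y ι : Type*} [MetricSpace X] [ProperSpace X]
    [UniformSpace Y] {F : ι → X → Y} {f : X → Y} {l : Filter ι} {c : X} {R : ℝ} :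
    TendstoLocallyUniformlyOn F f l (ball c R) ↔
      ∀ r < R, TendstoUniformlyOn F f l (closedBall c r) := by
  rw [tendstoLocallyUniformlyOn_iff_forall_isCompact isOpen_ball]
  refine ⟨fun h r hr => h _ (closedBall_subset_ball hr) (isCompact_closedBall _ _),
    fun h K hK hKc => ?_⟩
  obtain ⟨r, hr, hKr⟩ := exists_lt_subset_ball hKc.isClosed hK
  exact (h r hr).mono (hKr.trans ball_subset_closedBall)

variable {n : ℕ} {f g : E n → ℂ} {F G : ℕ → E n → ℂ}

lemma IsHarmonicExpansion.add (hF : IsHarmonicExpansion n f F) (hG : IsHarmonicExpansion n g G) :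
    IsHarmonicExpansion n (f + g) (F + G) where
  solid p := by
    obtain ⟨P, hP, hFP⟩ := isSolidHarmonic_iff.1 (hF.solid p)
    obtain ⟨Q, hQ, hGQ⟩ := isSolidHarmonic_iff.1 (hG.solid p)
    exact isSolidHarmonic_iff.2 ⟨P + Q, add_mem hP hQ, by rw [map_add, hFP, hGQ, Pi.add_apply]⟩
  tendsto := (hF.tendsto.add hG.tendsto).congr fun N x _ => by simp [Finset.sum_add_distrib]

lemma IsHarmonicExpansion.smul (hF : IsHarmonicExpansion n f F) (c : ℂ) :
    IsHarmonicExpansion n (c • f) (c • F) where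
  solid p := by
    obtain ⟨P, hP, hFP⟩ := isSolidHarmonic_iff.1 (hF.solid p)
    exact isSolidHarmonic_iff.2
      ⟨c • P, Submodule.smul_mem _ c hP, by rw [map_smul, hFP, Pi.smul_apply]⟩
  tendsto := ((lipschitzWith_smul c).uniformContinuous.comp_tendstoLocallyUniformlyOn
    hF.tendsto).congr fun N x _ => by simp [Finset.mul_sum]

lemma sqrt_polyNormSq_le [NeZero n] {P : MvPolynomial (Fin n) ℂ} {M : ℝ} (hM : 0 ≤ M)
    (h : ∀ ζ : sphere (0 : E n) 1, ‖polyFun P ζ‖ ≤ M) : √(polyNormSq P) ≤ M :=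
  (Real.sqrt_le_left hM).2 (polyNormSq_le_sq h)

lemma eventually_sqrt_polyNormSq_le [NeZero n] {P : ℕ → MvPolynomial (Fin n) ℂ}
    (hP : ∀ p, P p ∈ solidHarmonic (Fin n) ℂ p) {r : ℝ} (hr : 0 < r)
    (h : TendstoUniformlyOn (fun N x => ∑ p ∈ Finset.range N, polyFun (P p) x) f atTop
      (closedBall 0 r)) : ∀ᶠ p in atTop, √(polyNormSq (P p)) ≤ (r ^ p)⁻¹ := by
  obtain ⟨N, hN⟩ := Metric.uniformCauchySeqOn_iff.1 h.uniformCauchySeqOn 1 one_pos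
  filter_upwards [eventually_ge_atTop N] with p hp
  refine sqrt_polyNormSq_le (by positivity) fun ζ => ?_
  have hterm := hN (p + 1) (by lia) p hp (r • (ζ : E n)) (by simp [norm_smul, abs_of_pos hr])
  rw [dist_eq_norm, Finset.sum_range_succ_sub_sum,
    polyFun_smul_of_isHomogeneous (mem_solidHarmonic.1 (hP p)).1, norm_mul, norm_pow,
    Complex.norm_real, Real.norm_of_nonneg hr.le] at hterm
  rw [← one_div, le_div_iff₀' (by positivity)]
  exact hterm.le

variable [n.AtLeastTwo]

lemma IsHarmonicExpansion.exists_isHarmonicSeries (hF : IsHarmonicExpansion n f F) :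
    ∃ P : ℕ → MvPolynomial (Fin n) ℂ, IsHarmonicSeries P ∧ (∀ p, F p = polyFun (P p)) ∧
      Set.EqOn f (seriesSum P) (ball 0 1) := by
  choose P hP hFP using fun p => isSolidHarmonic_iff.1 (hF.solid p)
  have htendsto := hF.tendsto
  simp only [← hFP] at htendsto
  have hseries : IsHarmonicSeries P := by
    refine ⟨hP, fun s ⟨hs0, hs1⟩ => ?_⟩
    obtain ⟨r, hsr, hr1⟩ := exists_between hs1
    have hr0 : 0 < r := hs0.trans hsr
    refine (summable_geometric_of_lt_one (r := s / r) (by positivity)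
      ((div_lt_one hr0).2 hsr)).of_norm_bounded_eventually_nat ?_
    filter_upwards [eventually_sqrt_polyNormSq_le hP hr0
      (tendstoLocallyUniformlyOn_ball_iff.1 htendsto r hr1)] with p hp
    rw [Real.norm_of_nonneg (by positivity), div_pow, div_eq_mul_inv]
    gcongr
  refine ⟨P, hseries, fun p => (hFP p).symm, fun x hx => ?_⟩
  exact tendsto_nhds_unique (htendsto.tendsto_at hx)
    (hseries.hasSum (mem_ball_zero_iff.1 hx)).tendsto_sum_nat

end HarmonicExpansion

section Parseval

open MvPolynomial

variable {n : ℕ} [n.AtLeastTwo] {P : ℕ → MvPolynomial (Fin n) ℂ}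

lemma lintegral_sphere_enorm_sum_polyFun_sq (hP : ∀ p, P p ∈ solidHarmonic (Fin n) ℂ p)
    (s : Finset ℕ) (r : ℝ) :
    ∫⁻ ζ : sphere (0 : E n) 1, ‖∑ p ∈ s, polyFun (P p) (r • (ζ : E n))‖ₑ ^ 2 ∂(sphereMeasure n) =
      ∑ p ∈ s, ENNReal.ofReal (r ^ (2 * p) * polyNormSq (P p)) := by
  have hscale (p : ℕ) : polyNormSq ((r : ℂ) ^ p • P p) = r ^ (2 * p) * polyNormSq (P p) := by
    rw [polyNormSq_smul, norm_pow, Complex.norm_real, ← pow_mul, mul_comm p 2, pow_mul,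
      Real.norm_eq_abs, sq_abs, ← pow_mul]
  have hsum (ζ : sphere (0 : E n) 1) : ∑ p ∈ s, polyFun (P p) (r • (ζ : E n)) =
      polyFun (∑ p ∈ s, (r : ℂ) ^ p • P p) ζ := by
    simp [polyFun_smul_of_isHomogeneous (mem_solidHarmonic.1 (hP _)).1]
  have h := sphereNormSq_polyFun (∑ p ∈ s, (r : ℂ) ^ p • P p)
  rw [sphereNormSq, polyNormSq_sum fun p => Submodule.smul_mem _ _ (hP p),
    ENNReal.ofReal_sum_of_nonneg fun _ _ => polyNormSq_nonneg _] at h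
  simpa only [hsum, hscale] using h

namespace IsHarmonicSeries

lemma lintegral_sphere_enorm_seriesSum_sq (hP : IsHarmonicSeries P) {r : ℝ} (hr : |r| < 1) :
    ∫⁻ ζ : sphere (0 : E n) 1, ‖seriesSum P (r • (ζ : E n))‖ₑ ^ 2 ∂(sphereMeasure n) =
      ∑' p, ENNReal.ofReal (r ^ (2 * p) * polyNormSq (P p)) := by
  have hnorm (ζ : sphere (0 : E n) 1) : ‖r • (ζ : E n)‖ = |r| := by simp [norm_smul]
  obtain ⟨u, hu, hbound⟩ := hP.exists_summable_norm_polyFun_le hr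
  refine tendsto_nhds_unique ?_ ENNReal.summable.tendsto_sum_tsum_nat
  simp only [← lintegral_sphere_enorm_sum_polyFun_sq hP.solid]
  refine tendsto_lintegral_of_dominated_convergence (fun _ => ENNReal.ofReal (∑' p, u p) ^ 2)
    (fun N => ?_) (fun N => ae_of_all _ fun ζ => ?_) (by simp) (ae_of_all _ fun ζ => ?_)
  · have : Continuous fun ζ : sphere (0 : E n) 1 =>
        ∑ p ∈ Finset.range N, polyFun (P p) (r • (ζ : E n)) :=
      continuous_finsetSum _ fun p _ => (continuous_polyFun (P p)).comp (by fun_prop)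
    exact this.measurable.enorm.pow_const 2
  · have hu0 (p : ℕ) : 0 ≤ u p := (norm_nonneg _).trans (hbound p _ (hnorm ζ).le)
    beta_reduce
    rw [← ofReal_norm]
    gcongr
    calc _ ≤ ∑ p ∈ Finset.range N, ‖polyFun (P p) (r • (ζ : E n))‖ := norm_sum_le _ _
      _ ≤ ∑ p ∈ Finset.range N, u p := Finset.sum_le_sum fun p _ => hbound p _ (hnorm ζ).le
      _ ≤ ∑' p, u p := hu.sum_le_tsum _ fun p _ => hu0 p
  · have hsum := hP.hasSum (x := r • (ζ : E n)) (by rwa [hnorm])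
    exact ((ENNReal.continuous_pow 2).tendsto _).comp hsum.tendsto_sum_nat.enorm

lemma eq_zero_of_eqOn_zero (hP : IsHarmonicSeries P)
    (h : Set.EqOn (seriesSum P) 0 (ball 0 1)) (p : ℕ) : P p = 0 := by
  have hr : |(1 / 2 : ℝ)| < 1 := by norm_num [abs_of_pos]
  have hzero (ζ : sphere (0 : E n) 1) : seriesSum P ((1 / 2 : ℝ) • (ζ : E n)) = 0 :=
    h (by simpa [norm_smul] using hr)
  have hparseval := hP.lintegral_sphere_enorm_seriesSum_sq hr
  simp only [hzero, enorm_zero, ne_eq, OfNat.ofNat_ne_zero, not_false_eq_true, zero_pow,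
    lintegral_zero] at hparseval
  have hle := ENNReal.ofReal_eq_zero.1 (ENNReal.tsum_eq_zero.1 hparseval.symm p)
  exact eq_zero_of_polyNormSq_eq_zero (mem_solidHarmonic.1 (hP.solid p)).1
    (le_antisymm (nonpos_of_mul_nonpos_right hle (by positivity)) (polyNormSq_nonneg _))

end IsHarmonicSeries

variable {f : E n → ℂ} {F G : ℕ → E n → ℂ}

lemma IsHarmonicExpansion.unique (hF : IsHarmonicExpansion n f F)
    (hG : IsHarmonicExpansion n f G) : F = G := by
  have hsub := hF.add (hG.smul (-1))
  rw [neg_one_smul, neg_one_smul, ← sub_eq_add_neg, ← sub_eq_add_neg, sub_self] at hsub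
  obtain ⟨P, hP, hFG, hzero⟩ := hsub.exists_isHarmonicSeries
  funext p
  rw [← sub_eq_zero, ← Pi.sub_apply, hFG, hP.eq_zero_of_eqOn_zero hzero.symm, map_zero]

lemma IsHarmonicExpansion.component_eq (hF : IsHarmonicExpansion n f F) : component n f = F :=
  IsHarmonicExpansion.unique (Classical.epsilon_spec (p := IsHarmonicExpansion n f) ⟨F, hF⟩) hF

end Parseval

section BallNorm

variable {n : ℕ}

/-- The normalizing constant of the measure `ρ_s`. -/
def ballConst (n : ℕ) (s : ℝ) : ℝ :=
  Real.Gamma (n / 2 + s + 1) / (Real.pi ^ ((n : ℝ) / 2) * Real.Gamma (s + 1))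

lemma ballConst_nonneg {s : ℝ} (hs : -1 < s) : 0 ≤ ballConst n s :=
  div_nonneg (Real.Gamma_nonneg_of_nonneg (by linarith [(Nat.cast_nonneg n : (0 : ℝ) ≤ n)]))
    (mul_nonneg (by positivity) (Real.Gamma_pos_of_pos (by linarith)).le)

/-- The density of `ballMeasure n s` at distance `r` from the origin. -/
def radialWeight (n : ℕ) (s r : ℝ) : ℝ≥0∞ :=
  ENNReal.ofReal (ballConst n s * (1 - r ^ 2) ^ s)

@[fun_prop]
lemma measurable_radialWeight (s : ℝ) : Measurable (radialWeight n s) := by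
  unfold radialWeight
  fun_prop

lemma radialWeight_lt_top (s r : ℝ) : radialWeight n s r < ∞ := ENNReal.ofReal_lt_top

lemma ballNormSq_eq_setLIntegral (s : ℝ) (g : E n → ℂ) :
    ballNormSq n s g = ∫⁻ x in ball (0 : E n) 1, radialWeight n s ‖x‖ * ‖g x‖ₑ ^ 2 :=
  lintegral_withDensity_eq_lintegral_mul_non_measurable _
    ((measurable_radialWeight s).comp measurable_norm)
    (ae_of_all _ fun _ => radialWeight_lt_top s _) _

lemma ballNormSq_eq_lintegral_Ioo [NeZero n] {g : E n → ℂ} (hg : ContinuousOn g (ball 0 1))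
    (s : ℝ) :
    ballNormSq n s g = (volume : Measure (E n)).toSphere Set.univ *
      ∫⁻ r in Set.Ioo (0 : ℝ) 1, ENNReal.ofReal (r ^ (n - 1)) * (radialWeight n s r *
        ∫⁻ ζ : sphere (0 : E n) 1, ‖g (r • (ζ : E n))‖ₑ ^ 2 ∂(sphereMeasure n)) := by
  classical
  set G : E n → ℂ := (ball (0 : E n) 1).indicator g with hG
  have hGmeas : Measurable G := by
    rw [hG, ← Set.piecewise_eq_indicator]
    exact hg.measurable_piecewise continuousOn_const measurableSet_ball
  have hmeas : Measurable fun x => radialWeight n s ‖x‖ * ‖G x‖ₑ ^ 2 :=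
    ((measurable_radialWeight s).comp measurable_norm).mul (hGmeas.enorm.pow_const 2)
  have hcongr : Set.EqOn (fun x => radialWeight n s ‖x‖ * ‖g x‖ₑ ^ 2)
      (fun x => radialWeight n s ‖x‖ * ‖G x‖ₑ ^ 2) (ball 0 1) := fun x hx => by
    simp only [hG, Set.indicator_of_mem hx]
  rw [ballNormSq_eq_setLIntegral, setLIntegral_congr_fun measurableSet_ball hcongr,
    setLIntegral_ball_eq_lintegral_Ioo_lintegral_toSphere _ hmeas, finrank_euclideanSpace_fin,
    ← lintegral_const_mul' _ _ (measure_ne_top _ _)]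
  refine setLIntegral_congr_fun measurableSet_Ioo fun r ⟨hr0, hr1⟩ => ?_
  have hnorm (ζ : sphere (0 : E n) 1) : ‖r • (ζ : E n)‖ = r := by
    simp [norm_smul, abs_of_pos hr0]
  have hGg (ζ : sphere (0 : E n) 1) : G (r • (ζ : E n)) = g (r • (ζ : E n)) :=
    Set.indicator_of_mem (by rwa [mem_ball_zero_iff, hnorm]) _
  simp only [hnorm, hGg]
  rw [lintegral_const_mul' _ _ (radialWeight_lt_top s r).ne, toSphere_eq_smul_sphereMeasure,
    lintegral_smul_measure, ← toSphere_eq_smul_sphereMeasure, smul_eq_mul]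
  ring

lemma lintegral_Ioo_rpow_mul_rpow {a b : ℝ} (ha : 0 < a) (hb : 0 < b) :
    ∫⁻ x in Set.Ioo (0 : ℝ) 1, ENNReal.ofReal (x ^ (a - 1) * (1 - x) ^ (b - 1)) =
      ENNReal.ofReal (ProbabilityTheory.beta a b) := by
  have hpos := ProbabilityTheory.beta_pos ha hb
  have h := ProbabilityTheory.lintegral_betaPDF_eq_one ha hb
  simp only [ProbabilityTheory.lintegral_betaPDF, mul_assoc,
    ENNReal.ofReal_mul (one_div_pos.2 hpos).le] at h
  rw [lintegral_const_mul' _ _ ENNReal.ofReal_ne_top, one_div, ENNReal.ofReal_inv_of_pos hpos,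
    mul_comm] at h
  rw [ENNReal.eq_inv_of_mul_eq_one_left h, inv_inv]

lemma lintegral_Ioo_eq_lintegral_sq (g : ℝ → ℝ≥0∞) :
    ∫⁻ x in Set.Ioo (0 : ℝ) 1, g x =
      ∫⁻ r in Set.Ioo (0 : ℝ) 1, ENNReal.ofReal (2 * r) * g (r ^ 2) := by
  have himage : (fun r : ℝ => r ^ 2) '' Set.Ioo 0 1 = Set.Ioo 0 1 := by
    ext y
    constructor
    · rintro ⟨x, ⟨hx0, hx1⟩, rfl⟩
      exact ⟨by positivity, pow_lt_one₀ hx0.le hx1 two_ne_zero⟩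
    · rintro ⟨hy0, hy1⟩
      exact ⟨√y, ⟨Real.sqrt_pos.2 hy0, by simpa [Real.sqrt_lt' one_pos] using hy1⟩,
        Real.sq_sqrt hy0.le⟩
  have h := lintegral_image_eq_lintegral_abs_deriv_mul (s := Set.Ioo 0 1) (f := fun r : ℝ => r ^ 2)
    (f' := fun r => 2 * r) measurableSet_Ioo
    (fun x _ => by simpa using (hasDerivAt_pow 2 x).hasDerivWithinAt)
    (fun x hx y hy hxy => (sq_eq_sq₀ hx.1.le hy.1.le).1 hxy) g
  rw [himage] at h
  rw [h]
  exact setLIntegral_congr_fun measurableSet_Ioo fun r hr => by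
    simp only [abs_of_pos (mul_pos two_pos hr.1)]

lemma Gamma_add_natCast {x : ℝ} (hx : 0 < x) (p : ℕ) :
    Real.Gamma (x + p) = (ascPochhammer ℝ p).eval x * Real.Gamma x := by
  induction p with
  | zero => simp
  | succ p ih =>
    rw [ascPochhammer_succ_eval, Nat.cast_succ, ← add_assoc, Real.Gamma_add_one (by positivity), ih]
    ring

lemma toSphere_univ_eq [NeZero n] : (volume : Measure (E n)).toSphere Set.univ =
    ENNReal.ofReal (2 * Real.pi ^ ((n : ℝ) / 2) / Real.Gamma (n / 2)) := by
  have hn : (0 : ℝ) < n := Nat.cast_pos.2 (NeZero.pos n)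
  rw [Measure.toSphere_apply_univ, EuclideanSpace.volume_ball, finrank_euclideanSpace_fin,
    Fintype.card_fin, ENNReal.ofReal_one, one_pow, one_mul, ← ENNReal.ofReal_natCast n,
    ← ENNReal.ofReal_mul hn.le, Real.Gamma_add_one (by positivity), Real.sqrt_eq_rpow,
    ← Real.rpow_mul_natCast Real.pi_pos.le, one_div_mul_eq_div]
  congr 1
  field_simp

/-- The ratio `(n/2)_p / (n/2 + s + 1)_p` of the squared norms, in `L²(dρ_s)` and on the sphere, of
a solid harmonic of degree `p`. -/
def ballWeight (n : ℕ) (s : ℝ) (p : ℕ) : ℝ :=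
  (ascPochhammer ℝ p).eval ((n : ℝ) / 2) / (ascPochhammer ℝ p).eval (n / 2 + s + 1)

lemma ballWeight_eq_beta [NeZero n] {s : ℝ} (hs : -1 < s) (p : ℕ) :
    ballWeight n s p = 2 * Real.pi ^ ((n : ℝ) / 2) / Real.Gamma (n / 2) *
      (ballConst n s / 2 * ProbabilityTheory.beta (n / 2 + p) (s + 1)) := by
  have hn : (0 : ℝ) < n / 2 := half_pos (Nat.cast_pos.2 (NeZero.pos n))
  have hsum : (n : ℝ) / 2 + p + (s + 1) = n / 2 + s + 1 + p := by ring
  have hpoch : 0 < (ascPochhammer ℝ p).eval ((n : ℝ) / 2 + s + 1) :=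
    ascPochhammer_pos p _ (by linarith)
  have hΓ := (Real.Gamma_pos_of_pos hn).ne'
  have hΓs := (Real.Gamma_pos_of_pos (show 0 < s + 1 by linarith)).ne'
  have hΓns := (Real.Gamma_pos_of_pos (show (0 : ℝ) < n / 2 + s + 1 by linarith)).ne'
  rw [ballWeight, ballConst, ProbabilityTheory.beta, hsum, Gamma_add_natCast hn,
    Gamma_add_natCast (by linarith)]
  generalize (n : ℝ) / 2 + s + 1 = d at *
  field_simp

lemma pow_mul_radialWeight_mul_pow [NeZero n] {s : ℝ} (hs : -1 < s) (p : ℕ) {r : ℝ}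
    (hr : r ∈ Set.Ioo 0 1) :
    ENNReal.ofReal (r ^ (n - 1)) * (radialWeight n s r * ENNReal.ofReal (r ^ (2 * p))) =
      ENNReal.ofReal (ballConst n s / 2) * (ENNReal.ofReal (2 * r) *
        ENNReal.ofReal ((r ^ 2) ^ ((n : ℝ) / 2 + p - 1) * (1 - r ^ 2) ^ (s + 1 - 1))) := by
  obtain ⟨hr0, hr1⟩ := hr
  have hr2 : 0 ≤ 1 - r ^ 2 := by nlinarith
  have hconst := ballConst_nonneg (n := n) hs
  have hpow : (r ^ 2) ^ ((n : ℝ) / 2 + p - 1) * r = r ^ (n - 1) * r ^ (2 * p) := by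
    rw [← pow_add, ← Real.rpow_natCast_mul hr0.le, ← Real.rpow_add_one hr0.ne',
      ← Real.rpow_natCast]
    congr 1
    push_cast [Nat.cast_sub (NeZero.one_le : 1 ≤ n)]
    ring
  rw [radialWeight, add_sub_cancel_right, ← ENNReal.ofReal_mul (by positivity),
    ← ENNReal.ofReal_mul (by positivity), ← ENNReal.ofReal_mul (by positivity),
    ← ENNReal.ofReal_mul (by positivity)]
  congr 1
  linear_combination -ballConst n s * (1 - r ^ 2) ^ s * hpow

lemma toSphere_univ_mul_lintegral_radialWeight [NeZero n] {s : ℝ} (hs : -1 < s) (p : ℕ) :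
    (volume : Measure (E n)).toSphere Set.univ * ∫⁻ r in Set.Ioo (0 : ℝ) 1,
      ENNReal.ofReal (r ^ (n - 1)) * (radialWeight n s r * ENNReal.ofReal (r ^ (2 * p))) =
      ENNReal.ofReal (ballWeight n s p) := by
  have hn : (0 : ℝ) < n / 2 := half_pos (Nat.cast_pos.2 (NeZero.pos n))
  rw [setLIntegral_congr_fun measurableSet_Ioo fun _ hr => pow_mul_radialWeight_mul_pow hs p hr,
    lintegral_const_mul' _ _ ENNReal.ofReal_ne_top, ← lintegral_Ioo_eq_lintegral_sq fun x =>
      ENNReal.ofReal (x ^ ((n : ℝ) / 2 + p - 1) * (1 - x) ^ (s + 1 - 1)),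
    lintegral_Ioo_rpow_mul_rpow (by positivity) (by linarith), toSphere_univ_eq,
    ← ENNReal.ofReal_mul (div_nonneg (ballConst_nonneg hs) zero_le_two), ← ENNReal.ofReal_mul,
    ballWeight_eq_beta hs]
  exact div_nonneg (by positivity) (Real.Gamma_pos_of_pos hn).le

lemma IsHarmonicSeries.ballNormSq_eq_tsum [n.AtLeastTwo] {P : ℕ → MvPolynomial (Fin n) ℂ}
    (hP : IsHarmonicSeries P) {g : E n → ℂ} (hg : Set.EqOn g (seriesSum P) (ball 0 1)) {s : ℝ}
    (hs : -1 < s) :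
    ballNormSq n s g = ∑' p, ENNReal.ofReal (ballWeight n s p) *
      ENNReal.ofReal (polyNormSq (P p)) := by
  have hsphere : Set.EqOn (fun r => ENNReal.ofReal (r ^ (n - 1)) * (radialWeight n s r *
      ∫⁻ ζ : sphere (0 : E n) 1, ‖g (r • (ζ : E n))‖ₑ ^ 2 ∂(sphereMeasure n)))
      (fun r => ∑' p, ENNReal.ofReal (r ^ (n - 1)) * (radialWeight n s r *
        ENNReal.ofReal (r ^ (2 * p))) * ENNReal.ofReal (polyNormSq (P p))) (Set.Ioo 0 1) := by
    rintro r ⟨hr0, hr1⟩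
    have hr : |r| < 1 := by rwa [abs_of_pos hr0]
    have hgP (ζ : sphere (0 : E n) 1) : g (r • (ζ : E n)) = seriesSum P (r • (ζ : E n)) :=
      hg (by simpa [norm_smul] using hr)
    simp only [hgP]
    rw [hP.lintegral_sphere_enorm_seriesSum_sq hr, ← ENNReal.tsum_mul_left, ← ENNReal.tsum_mul_left]
    refine tsum_congr fun p => ?_
    rw [ENNReal.ofReal_mul (by positivity)]
    ring
  rw [ballNormSq_eq_lintegral_Ioo (hP.continuousOn.congr hg),
    setLIntegral_congr_fun measurableSet_Ioo hsphere, lintegral_tsum fun p => by fun_prop,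
    ← ENNReal.tsum_mul_left]
  refine tsum_congr fun p => ?_
  rw [lintegral_mul_const' _ _ ENNReal.ofReal_ne_top, ← mul_assoc,
    toSphere_univ_mul_lintegral_radialWeight hs]

end BallNorm

section Weights

open MvPolynomial

variable {n : ℕ}

lemma iteratedRotDeriv_mem_solidHarmonic {m p : ℕ} {P : MvPolynomial (Fin n) ℂ}
    (hP : P ∈ solidHarmonic (Fin n) ℂ p) (J : Fin m → PairIndex n) :
    iteratedRotDeriv J P ∈ solidHarmonic (Fin n) ℂ p := by
  induction m with
  | zero => exact hP
  | succ m ih =>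
    rw [iteratedRotDeriv_succ]
    exact rotDeriv_mem_solidHarmonic (ih _) _ _

lemma sum_polyNormSq_iteratedRotDeriv [n.AtLeastTwo] {p : ℕ} {P : MvPolynomial (Fin n) ℂ}
    (hP : P ∈ solidHarmonic (Fin n) ℂ p) (m : ℕ) :
    ∑ J : Fin m → PairIndex n, polyNormSq (iteratedRotDeriv J P) =
      (2 * (p * (p + n - 2)) : ℝ) ^ m * polyNormSq P := by
  induction m with
  | zero => simp [iteratedRotDeriv_zero]
  | succ m ih =>
    rw [← (Fin.consEquiv fun _ => PairIndex n).sum_comp, Fintype.sum_prod_type_right]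
    have htail (a : PairIndex n) (J : Fin m → PairIndex n) :
        Fin.tail (Fin.consEquiv (fun _ => PairIndex n) (a, J)) = J := Fin.tail_cons _ _
    simp only [iteratedRotDeriv_succ, Fin.consEquiv_apply, Fin.cons_zero, htail,
      sum_pairIndex_polyNormSq_rotDeriv (iteratedRotDeriv_mem_solidHarmonic hP _)]
    rw [← Finset.mul_sum, ih]
    ring

/-- The ratio of `tangentialNormSq n m` and the squared norm on the sphere, for a solid harmonic of
degree `p`. -/
def tangentialWeight (n m p : ℕ) : ℝ :=
  (2 * (p * (p + n - 2))) ^ m * ballWeight n (2 * m - n / 2 - 1) p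

lemma IsHarmonicExpansion.tangentialNormSq_eq_tsum [n.AtLeastTwo] {f : E n → ℂ}
    {F : ℕ → E n → ℂ} (hF : IsHarmonicExpansion n f F) {m : ℕ} (hm : (n : ℝ) / 4 < m) :
    tangentialNormSq n m f =
      ∑' p, ENNReal.ofReal (tangentialWeight n m p) * sphereNormSq n (F p) := by
  obtain ⟨P, hP, hFP, hfP⟩ := hF.exists_isHarmonicSeries
  have hs : -1 < 2 * (m : ℝ) - n / 2 - 1 := by linarith
  simp only [tangentialNormSq, fun J : Fin m → PairIndex n =>
    (hP.iteratedRotDeriv J).ballNormSq_eq_tsum (hP.eqOn_iteratedTangential hfP J) hs]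
  rw [← Summable.tsum_finsetSum fun _ _ => ENNReal.summable]
  refine tsum_congr fun p => ?_
  have hsum := sum_polyNormSq_iteratedRotDeriv (hP.solid p) m
  have hsymbol : (0 : ℝ) ≤ 2 * (p * (p + n - 2)) := by
    have : (2 : ℝ) ≤ n := by exact_mod_cast Nat.AtLeastTwo.prop
    have : (0 : ℝ) ≤ p + n - 2 := by linarith [(Nat.cast_nonneg p : (0 : ℝ) ≤ p)]
    positivity
  rw [← Finset.mul_sum, ← ENNReal.ofReal_sum_of_nonneg fun _ _ => polyNormSq_nonneg _, hsum, hFP,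
    sphereNormSq_polyFun, tangentialWeight, ENNReal.ofReal_mul (by positivity),
    ENNReal.ofReal_mul (by positivity)]
  ring

lemma pow_mul_factorial_le_factorial_add (p k : ℕ) : p ^ k * p ! ≤ (p + k)! :=
  (mul_comm _ _).trans_le <| (Nat.mul_le_mul_left _ (Nat.pow_le_pow_left p.le_succ k)).trans
    Nat.factorial_mul_pow_le_factorial

lemma factorial_add_le_pow_mul_factorial {p : ℕ} (hp : 1 ≤ p) (k : ℕ) :
    (p + k)! ≤ ((k + 1) * p) ^ k * p ! := by
  rw [← Nat.factorial_mul_ascFactorial, mul_comm]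
  refine Nat.mul_le_mul_right _ ((Nat.ascFactorial_le_pow_add p k).trans ?_)
  gcongr
  nlinarith

lemma pow_two_mul_le_eigenvalue_pow [n.AtLeastTwo] (m p : ℕ) :
    (p : ℝ) ^ (2 * m) ≤ (p * (p + n - 2)) ^ m := by
  have hn : (2 : ℝ) ≤ n := mod_cast Nat.AtLeastTwo.prop
  rw [pow_mul]
  gcongr
  nlinarith [(Nat.cast_nonneg p : (0 : ℝ) ≤ p)]

lemma eigenvalue_pow_le [n.AtLeastTwo] (m p : ℕ) :
    ((p : ℝ) * (p + n - 2)) ^ m ≤ n ^ m * p ^ (2 * m) := by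
  have hn : (2 : ℝ) ≤ n := mod_cast Nat.AtLeastTwo.prop
  obtain rfl | hp := p.eq_zero_or_pos
  · cases m <;> simp
  have hp1 : (1 : ℝ) ≤ p := mod_cast hp
  rw [pow_mul, ← mul_pow]
  refine pow_le_pow_left₀ (mul_nonneg (by linarith) (by linarith)) ?_ m
  rw [sq, mul_left_comm]
  gcongr
  nlinarith

lemma div_factorial_le_eigenvalue_pow_div [n.AtLeastTwo] {m k : ℕ} (hk : 2 * m = k + 1) (p : ℕ) :
    (p : ℝ) / p ! ≤ (k + 1) ^ k * ((p * (p + n - 2)) ^ m / (p + k)!) := by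
  obtain rfl | hp := p.eq_zero_or_pos
  · simp [show m ≠ 0 by lia]
  have hfact : ((p + k)! : ℝ) ≤ ((k + 1) * p) ^ k * p ! :=
    mod_cast factorial_add_le_pow_mul_factorial hp k
  rw [← mul_div_assoc, div_le_div_iff₀ (by positivity) (by positivity)]
  calc (p : ℝ) * (p + k)! ≤ p * (((k + 1) * p) ^ k * p !) := by gcongr
    _ = (k + 1) ^ k * (p : ℝ) ^ (2 * m) * p ! := by rw [hk, mul_pow]; ring
    _ ≤ _ := by gcongr; exact pow_two_mul_le_eigenvalue_pow m p

lemma eigenvalue_pow_div_le [n.AtLeastTwo] {m k : ℕ} (hk : 2 * m = k + 1) (p : ℕ) :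
    ((p : ℝ) * (p + n - 2)) ^ m / (p + k)! ≤ n ^ m * (p / p !) := by
  have hfact : (p : ℝ) ^ k * p ! ≤ (p + k)! := mod_cast pow_mul_factorial_le_factorial_add p k
  rw [← mul_div_assoc, div_le_div_iff₀ (by positivity) (by positivity)]
  calc _ ≤ (n : ℝ) ^ m * p ^ (2 * m) * p ! := by gcongr; exact eigenvalue_pow_le m p
    _ = n ^ m * p * ((p : ℝ) ^ k * p !) := by rw [hk]; ring
    _ ≤ _ := by gcongr

lemma tangentialWeight_eq {m k : ℕ} (hk : 2 * m = k + 1) (p : ℕ) :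
    tangentialWeight n m p = 2 ^ m * k ! * (ascPochhammer ℝ p).eval ((n : ℝ) / 2) *
      ((p * (p + n - 2)) ^ m / (p + k)!) := by
  have hkR : (2 * m : ℝ) = k + 1 := mod_cast hk
  have hk0 : (k ! : ℝ) ≠ 0 := Nat.cast_ne_zero.2 (Nat.factorial_ne_zero k)
  have hpoch := factorial_mul_ascPochhammer ℝ k p
  rw [tangentialWeight, ballWeight, show (n : ℝ) / 2 + (2 * m - n / 2 - 1) + 1 = k + 1 by linarith,
    add_comm p k, ← hpoch, mul_pow]
  field_simp

lemma exists_tangentialWeight_bounds [n.AtLeastTwo] {m : ℕ} (hm : m ≠ 0) :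
    ∃ c C : ℝ, 0 < c ∧ 0 < C ∧ ∀ p, c * dirichletCoeff n p ≤ tangentialWeight n m p ∧
      tangentialWeight n m p ≤ C * dirichletCoeff n p := by
  obtain ⟨k, hk⟩ : ∃ k, 2 * m = k + 1 := Nat.exists_eq_succ_of_ne_zero (by lia)
  have hn : (0 : ℝ) < n / 2 := half_pos (Nat.cast_pos.2 (NeZero.pos n))
  refine ⟨2 ^ m * k ! / (k + 1) ^ k, 2 ^ m * k ! * n ^ m, by positivity,
    mul_pos (by positivity) (pow_pos (by linarith) m), fun p => ?_⟩
  have hpoch := (ascPochhammer_pos p _ hn).le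
  rw [tangentialWeight_eq hk, dirichletCoeff]
  constructor
  · rw [div_mul_eq_mul_div, div_le_iff₀ (by positivity)]
    calc _ = 2 ^ m * k ! * (ascPochhammer ℝ p).eval ((n : ℝ) / 2) * (p / p !) := by ring
      _ ≤ 2 ^ m * k ! * (ascPochhammer ℝ p).eval ((n : ℝ) / 2) *
          ((k + 1) ^ k * ((p * (p + n - 2)) ^ m / (p + k)!)) := by
        gcongr
        exact div_factorial_le_eigenvalue_pow_div hk p
      _ = _ := by ring
  · calc _ ≤ 2 ^ m * k ! * (ascPochhammer ℝ p).eval ((n : ℝ) / 2) * (n ^ m * (p / p !)) := by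
          gcongr
          exact eigenvalue_pow_div_le hk p
      _ = _ := by ring

end Weights

section MaximumPrinciple

open Laplacian

lemma deriv_deriv_nonpos_of_isLocalMax {g : ℝ → ℝ} {a : ℝ} (hg : ContinuousAt g a)
    (h : IsLocalMax g a) : deriv (deriv g) a ≤ 0 := by
  by_contra! hpos
  have hmin := isLocalMin_of_deriv_deriv_pos hpos h.deriv_eq_zero hg
  have hconst : g =ᶠ[𝓝 a] fun _ => g a := by
    filter_upwards [hmin, h] with t h₁ h₂ using le_antisymm h₂ h₁
  simp [hconst.deriv.deriv_eq] at hpos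

lemma fderiv_fderiv_nonpos_of_isLocalMax {V : Type*} [NormedAddCommGroup V] [NormedSpace ℝ V]
    {w : V → ℝ} {x : V} (hw : ContDiffAt ℝ 2 w x) (h : IsLocalMax w x) (e : V) :
    fderiv ℝ (fun y => fderiv ℝ w y e) x e ≤ 0 := by
  have hline (t : ℝ) : HasDerivAt (fun t : ℝ => x + t • e) e t := by
    simpa using ((hasDerivAt_id t).smul_const e).const_add x
  have htendsto : Tendsto (fun t : ℝ => x + t • e) (𝓝 0) (𝓝 x) := by
    simpa using (hline 0).continuousAt.tendsto
  have hderiv : deriv (fun t : ℝ => w (x + t • e)) =ᶠ[𝓝 0] fun t => fderiv ℝ w (x + t • e) e := by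
    filter_upwards [htendsto.eventually (hw.eventually (by simp))] with t ht
    exact ((ht.differentiableAt two_ne_zero).hasFDerivAt.comp_hasDerivAt t (hline t)).deriv
  have hdiff : DifferentiableAt ℝ (fun y => fderiv ℝ w y e) x :=
    ((hw.fderiv_right (m := 1) (by norm_num)).differentiableAt one_ne_zero).clm_apply
      (differentiableAt_const e)
  have hderiv₂ : deriv (fun t : ℝ => fderiv ℝ w (x + t • e) e) 0 =
      fderiv ℝ (fun y => fderiv ℝ w y e) x e :=
    (hdiff.hasFDerivAt.comp_hasDerivAt_of_eq 0 (hline 0) (by simp)).deriv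
  have hcont : ContinuousAt (fun t : ℝ => w (x + t • e)) 0 :=
    hw.continuousAt.comp_of_eq (hline 0).continuousAt (by simp)
  have hmax : IsLocalMax (fun t : ℝ => w (x + t • e)) 0 := by
    filter_upwards [htendsto.eventually h] with t ht using by simpa using ht
  rw [← hderiv₂, ← hderiv.deriv_eq]
  exact deriv_deriv_nonpos_of_isLocalMax hcont hmax

variable {V F : Type*} [NormedAddCommGroup V] [InnerProductSpace ℝ V] [FiniteDimensional ℝ V]
  [NormedAddCommGroup F] [NormedSpace ℝ F] {r M : ℝ} {x : V}

lemma laplacian_nonpos_of_isLocalMax {w : V → ℝ} (hw : ContDiffAt ℝ 2 w x)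
    (h : IsLocalMax w x) : Δ w x ≤ 0 := by
  rw [laplacian_eq_sum_fderiv_fderiv (stdOrthonormalBasis ℝ V) hw]
  exact Finset.sum_nonpos fun i _ => fderiv_fderiv_nonpos_of_isLocalMax hw h _

lemma laplacian_norm_sq (x : V) : Δ (fun y : V => ‖y‖ ^ 2) x = 2 * Module.finrank ℝ V := by
  rw [laplacian_eq_sum_fderiv_fderiv (stdOrthonormalBasis ℝ V) (contDiff_norm_sq ℝ).contDiffAt]
  have hfderiv (y e : V) : fderiv ℝ (fun y : V => ‖y‖ ^ 2) y e = 2 * inner ℝ y e := by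
    simp [fderiv_norm_sq_apply]
  have hfderiv₂ (e : V) : fderiv ℝ (fun y : V => 2 * inner ℝ y e) x e = 2 * ‖e‖ ^ 2 := by
    rw [fderiv_const_mul (differentiableAt_fun_id.inner ℝ (differentiableAt_const e))]
    simp [fderiv_inner_apply, differentiableAt_fun_id]
  simp only [hfderiv, hfderiv₂]
  simp [mul_comm]

lemma exists_norm_eq_and_le_of_laplacian_pos {w : V → ℝ}
    (hw : ∀ y ∈ closedBall 0 r, ContDiffAt ℝ 2 w y) (hpos : ∀ y ∈ closedBall 0 r, 0 < Δ w y)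
    (hx : ‖x‖ ≤ r) : ∃ y, ‖y‖ = r ∧ w x ≤ w y := by
  have hx' : x ∈ closedBall 0 r := mem_closedBall_zero_iff.2 hx
  obtain ⟨y, hy, hmax⟩ := (isCompact_closedBall (0 : V) r).exists_isMaxOn ⟨x, hx'⟩
    fun y hy => (hw y hy).continuousAt.continuousWithinAt
  refine ⟨y, (mem_closedBall_zero_iff.1 hy).eq_of_not_lt fun hlt => ?_, hmax hx'⟩
  have hloc : IsLocalMax w y := hmax.isLocalMax (closedBall_mem_nhds_of_mem (by simpa using hlt))
  exact (hpos y hy).not_ge (laplacian_nonpos_of_isLocalMax (hw y hy) hloc)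

lemma le_of_le_on_sphere [Nontrivial V] {u : V → ℝ} (hu : HarmonicOnNhd u (closedBall 0 r))
    (hM : ∀ y, ‖y‖ = r → u y ≤ M) (hx : ‖x‖ ≤ r) : u x ≤ M := by
  -- `u + δ‖·‖²` has positive Laplacian; let `δ → 0`.
  have hperturbed {δ : ℝ} (hδ : 0 < δ) : u x ≤ M + δ * r ^ 2 := by
    have hsq (y : V) : ContDiffAt ℝ 2 (fun y : V => ‖y‖ ^ 2) y := (contDiff_norm_sq ℝ).contDiffAt
    have hδsq (y : V) : ContDiffAt ℝ 2 (δ • fun z : V => ‖z‖ ^ 2) y := (hsq y).const_smul δ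
    have hpos : ∀ y ∈ closedBall (0 : V) r, 0 < Δ (u + δ • fun z : V => ‖z‖ ^ 2) y := by
      intro y hy
      rw [(hu y hy).1.laplacian_add (hδsq y), (hu y hy).2.self_of_nhds,
        laplacian_smul δ (hsq y), laplacian_norm_sq]
      have : 0 < Module.finrank ℝ V := Module.finrank_pos
      simp only [Pi.zero_apply, smul_eq_mul, zero_add]
      positivity
    obtain ⟨y, hy, hxy⟩ := exists_norm_eq_and_le_of_laplacian_pos
      (w := u + δ • fun z : V => ‖z‖ ^ 2) (fun y hy => (hu y hy).1.add (hδsq y)) hpos hx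
    have := hM y hy
    simp only [Pi.add_apply, Pi.smul_apply, smul_eq_mul, hy] at hxy
    nlinarith [sq_nonneg ‖x‖]
  refine le_of_forall_pos_le_add fun ε hε => ?_
  calc u x ≤ M + ε / (r ^ 2 + 1) * r ^ 2 := hperturbed (by positivity)
    _ ≤ M + ε := by
      gcongr
      rw [div_mul_eq_mul_div, div_le_iff₀ (by positivity)]
      nlinarith

lemma norm_le_of_norm_le_on_sphere [Nontrivial V] {f : V → F}
    (hf : HarmonicOnNhd f (closedBall 0 r)) (hM : ∀ y, ‖y‖ = r → ‖f y‖ ≤ M) (hx : ‖x‖ ≤ r) :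
    ‖f x‖ ≤ M := by
  obtain ⟨ℓ, hℓ, hℓx⟩ := exists_dual_vector'' ℝ (f x)
  have hharm : HarmonicOnNhd (ℓ ∘ f) (closedBall 0 r) := fun y hy => (hf y hy).comp_CLM ℓ
  have hle (y : V) : ℓ (f y) ≤ ‖f y‖ :=
    (le_abs_self _).trans ((ℓ.le_opNorm _).trans (mul_le_of_le_one_left (norm_nonneg _) hℓ))
  calc ‖f x‖ = (ℓ ∘ f) x := hℓx.symm
    _ ≤ M := le_of_le_on_sphere hharm (fun y hy => (hle y).trans (hM y hy)) hx

end MaximumPrinciple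

section DirichletProblem

open MvPolynomial

variable {n : ℕ} {P Q : MvPolynomial (Fin n) ℂ} {r M : ℝ}

lemma pow_mul_sqrt_polyNormSq_homogeneousComponent_le [n.AtLeastTwo] (hQ : polyLaplacian Q = 0)
    (hr : 0 ≤ r) (hM : 0 ≤ M) (h : ∀ x : E n, ‖x‖ = r → ‖polyFun Q x‖ ≤ M) (p : ℕ) :
    r ^ p * √(polyNormSq (homogeneousComponent p Q)) ≤ M := by
  obtain hp | hp := lt_or_ge Q.totalDegree p
  · simpa [homogeneousComponent_eq_zero p Q hp] using hM
  have hsolid (q : ℕ) : homogeneousComponent q Q ∈ solidHarmonic (Fin n) ℂ q :=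
    homogeneousComponent_mem_solidHarmonic hQ q
  have hscaled (ζ : sphere (0 : E n) 1) :
      ‖polyFun (∑ q ∈ Finset.range (Q.totalDegree + 1),
        (r : ℂ) ^ q • homogeneousComponent q Q) ζ‖ ≤ M := by
    have hsum : ∑ q ∈ Finset.range (Q.totalDegree + 1),
        (r : ℂ) ^ q • polyFun (homogeneousComponent q Q) ζ = polyFun Q (r • (ζ : E n)) := by
      conv_rhs => rw [← sum_homogeneousComponent Q]
      simp [polyFun_smul_of_isHomogeneous (mem_solidHarmonic.1 (hsolid _)).1]
    simpa [← hsum] using h (r • (ζ : E n)) (by simp [norm_smul, abs_of_nonneg hr])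
  calc r ^ p * √(polyNormSq (homogeneousComponent p Q))
      = √(polyNormSq ((r : ℂ) ^ p • homogeneousComponent p Q)) := by
        rw [polyNormSq_smul, norm_pow, Complex.norm_real, Real.norm_of_nonneg hr,
          Real.sqrt_mul (by positivity), Real.sqrt_sq (by positivity)]
    _ ≤ √(polyNormSq (∑ q ∈ Finset.range (Q.totalDegree + 1),
          (r : ℂ) ^ q • homogeneousComponent q Q)) := by
        rw [polyNormSq_sum fun q => Submodule.smul_mem _ _ (hsolid q)]
        exact Real.sqrt_le_sqrt (Finset.single_le_sum
          (f := fun q => polyNormSq ((r : ℂ) ^ q • homogeneousComponent q Q))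
          (fun _ _ => polyNormSq_nonneg _) (Finset.mem_range.2 (Nat.lt_succ_of_le hp)))
    _ ≤ M := sqrt_polyNormSq_le hM hscaled

lemma eq_zero_of_polyLaplacian_eq_zero_of_eq_zero_on_sphere [n.AtLeastTwo] (hr : 0 < r)
    (hQ : polyLaplacian Q = 0) (h : ∀ x : E n, ‖x‖ = r → polyFun Q x = 0) : Q = 0 := by
  rw [← sum_homogeneousComponent Q]
  refine Finset.sum_eq_zero fun p _ => ?_
  have hle := pow_mul_sqrt_polyNormSq_homogeneousComponent_le hQ hr.le le_rfl
    (fun x hx => by simp [h x hx]) p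
  have hsqrt := nonpos_of_mul_nonpos_right hle (by positivity)
  exact eq_zero_of_polyNormSq_eq_zero (homogeneousComponent_isHomogeneous p Q)
    (le_antisymm (Real.sqrt_eq_zero'.1 (le_antisymm hsqrt (Real.sqrt_nonneg _)))
      (polyNormSq_nonneg _))

/-- The polynomial `r² - |x|²`, which cuts out the sphere of radius `r`. -/
def spherePoly (n : ℕ) (r : ℝ) : MvPolynomial (Fin n) ℂ := C ((r : ℂ) ^ 2) - psum (Fin n) ℂ 2

lemma polyFun_spherePoly (x : E n) : polyFun (spherePoly n r) x = (r : ℂ) ^ 2 - (‖x‖ : ℂ) ^ 2 := by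
  simp [spherePoly, polyFun_psum_two]

lemma spherePoly_ne_zero (hr : 0 < r) : spherePoly n r ≠ 0 := by
  intro h
  have hr₂ := (polyFun_spherePoly (r := r) (0 : E n)).symm
  simp [h, hr.ne'] at hr₂

lemma totalDegree_spherePoly_le : (spherePoly n r).totalDegree ≤ 2 :=
  (totalDegree_sub _ _).trans (max_le ((totalDegree_C _).trans_le zero_le_two)
    (totalDegree_finsetSum_le fun i _ => (totalDegree_X_pow i 2).le))

/-- The operator `Q ↦ Δ((r² - |x|²) Q)` on polynomials of degree at most `d`. Inverting it solves
the Dirichlet problem on the ball of radius `r` for polynomial boundary values. -/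
def laplacianSpherePolyMul (n : ℕ) (r : ℝ) (d : ℕ) :
    restrictTotalDegree (Fin n) ℂ d →ₗ[ℂ] restrictTotalDegree (Fin n) ℂ d :=
  (polyLaplacian ∘ₗ LinearMap.mulLeft ℂ (spherePoly n r)).restrict fun Q hQ => by
    rw [mem_restrictTotalDegree] at hQ ⊢
    have hmul := totalDegree_mul (spherePoly n r) Q
    have hsphere := totalDegree_spherePoly_le (n := n) (r := r)
    have hlap := totalDegree_polyLaplacian_le (spherePoly n r * Q)
    simp only [LinearMap.comp_apply, LinearMap.mulLeft_apply]
    lia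

lemma laplacianSpherePolyMul_injective [n.AtLeastTwo] (hr : 0 < r) (d : ℕ) :
    Function.Injective (laplacianSpherePolyMul n r d) := by
  refine (injective_iff_map_eq_zero _).2 fun Q hQ => ?_
  have hmul : spherePoly n r * Q.1 = 0 :=
    eq_zero_of_polyLaplacian_eq_zero_of_eq_zero_on_sphere hr (congrArg Subtype.val hQ)
      fun x hx => by simp [polyFun_spherePoly, hx]
  exact Subtype.ext ((mul_eq_zero.1 hmul).resolve_left (spherePoly_ne_zero hr))

lemma exists_harmonic_eq_on_sphere [n.AtLeastTwo] (hr : 0 < r) (P : MvPolynomial (Fin n) ℂ) :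
    ∃ H, polyLaplacian H = 0 ∧ ∀ x : E n, ‖x‖ = r → polyFun H x = polyFun P x := by
  have hdeg : polyLaplacian P ∈ restrictTotalDegree (Fin n) ℂ P.totalDegree :=
    (mem_restrictTotalDegree _ _ _).2 ((totalDegree_polyLaplacian_le P).trans tsub_le_self)
  obtain ⟨Q, hQ⟩ := LinearMap.injective_iff_surjective.1
    (laplacianSpherePolyMul_injective hr P.totalDegree) ⟨polyLaplacian P, hdeg⟩
  have hlap : polyLaplacian (spherePoly n r * Q.1) = polyLaplacian P := congrArg Subtype.val hQ
  refine ⟨P - spherePoly n r * Q.1, by rw [map_sub, hlap, sub_self], fun x hx => ?_⟩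
  simp [polyFun_spherePoly, hx]

end DirichletProblem

section StoneWeierstrass

open MvPolynomial

variable {n : ℕ} {r ε : ℝ} {f : E n → ℂ}

/-- The algebra of restrictions of polynomial functions to the sphere of radius `r`. -/
def spherePolyAlgebra (n : ℕ) (r : ℝ) : StarSubalgebra ℂ C(sphere (0 : E n) r, ℂ) where
  carrier := {g | ∃ P : MvPolynomial (Fin n) ℂ, ∀ x : sphere (0 : E n) r, g x = polyFun P x}
  mul_mem' := by rintro _ _ ⟨P, hP⟩ ⟨Q, hQ⟩; exact ⟨P * Q, fun x => by simp [hP, hQ]⟩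
  add_mem' := by rintro _ _ ⟨P, hP⟩ ⟨Q, hQ⟩; exact ⟨P + Q, fun x => by simp [hP, hQ]⟩
  algebraMap_mem' c := ⟨C c, fun x => by simp⟩
  star_mem' := by
    rintro _ ⟨P, hP⟩
    exact ⟨P.map (starRingEnd ℂ), fun x => by simp [hP, polyFun_map_conj]⟩

lemma spherePolyAlgebra_separatesPoints (n : ℕ) (r : ℝ) :
    (spherePolyAlgebra n r).SeparatesPoints := by
  intro x y hxy
  obtain ⟨i, hi⟩ : ∃ i, (x : E n) i ≠ (y : E n) i := by
    by_contra! h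
    exact hxy (Subtype.ext (PiLp.ext h))
  refine ⟨_, ⟨⟨_, (continuous_polyFun (X i)).comp continuous_subtype_val⟩,
    ⟨X i, fun _ => rfl⟩, rfl⟩, ?_⟩
  simpa using hi

lemma exists_polyFun_near_on_sphere (hε : 0 < ε) (hf : ContinuousOn f (sphere 0 r)) :
    ∃ P : MvPolynomial (Fin n) ℂ, ∀ x : E n, ‖x‖ = r → ‖f x - polyFun P x‖ ≤ ε := by
  let g : C(sphere (0 : E n) r, ℂ) := ⟨fun x => f x, continuousOn_iff_continuous_domRestrict.1 hf⟩
  have hg : g ∈ closure (spherePolyAlgebra n r : Set C(sphere (0 : E n) r, ℂ)) := by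
    rw [← StarSubalgebra.topologicalClosure_coe,
      ContinuousMap.starSubalgebra_topologicalClosure_eq_top_of_separatesPoints _
        (spherePolyAlgebra_separatesPoints n r)]
    trivial
  obtain ⟨h, ⟨P, hP⟩, hgh⟩ := Metric.mem_closure_iff.1 hg ε hε
  refine ⟨P, fun x hx => ?_⟩
  rw [← hP ⟨x, mem_sphere_zero_iff_norm.2 hx⟩, ← dist_eq_norm]
  exact (ContinuousMap.dist_apply_le_dist (f := g) ⟨x, _⟩).trans hgh.le

lemma exists_harmonic_near [n.AtLeastTwo] (hf : HarmonicOnNhd f (ball 0 1)) (hr₀ : 0 < r)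
    (hr₁ : r < 1) (hε : 0 < ε) : ∃ H : MvPolynomial (Fin n) ℂ, polyLaplacian H = 0 ∧
      ∀ x : E n, ‖x‖ ≤ r → ‖f x - polyFun H x‖ ≤ ε := by
  have hf' : HarmonicOnNhd f (closedBall 0 r) := hf.mono (closedBall_subset_ball hr₁)
  obtain ⟨P, hP⟩ := exists_polyFun_near_on_sphere hε
    (hf'.continuousOn.mono sphere_subset_closedBall)
  obtain ⟨H, hH, hHP⟩ := exists_harmonic_eq_on_sphere hr₀ P
  have hsub : HarmonicOnNhd (f - polyFun H) (closedBall 0 r) :=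
    hf'.sub ((harmonicOnNhd_polyFun_iff.2 hH).mono (Set.subset_univ _))
  refine ⟨H, hH, fun x hx =>
    norm_le_of_norm_le_on_sphere (f := f - polyFun H) hsub (fun y hy => ?_) hx⟩
  simpa [hHP y hy] using hP y hy

end StoneWeierstrass

section Existence

open MvPolynomial

variable {n : ℕ} {f : E n → ℂ} {r s R M : ℝ} {Q : MvPolynomial (Fin n) ℂ}
  {H : ℕ → MvPolynomial (Fin n) ℂ} {F : ℕ → E n → ℂ}

lemma isClosed_setOf_isSolidHarmonic (n p : ℕ) : IsClosed {g | IsSolidHarmonic n p g} := by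
  have hle : solidHarmonic (Fin n) ℂ p ≤ restrictTotalDegree (Fin n) ℂ p := fun P hP =>
    (mem_restrictTotalDegree _ _ _).2 (mem_solidHarmonic.1 hP).1.totalDegree_le
  have : FiniteDimensional ℂ (solidHarmonic (Fin n) ℂ p) := Submodule.finiteDimensional_of_le hle
  have hmap : {g | IsSolidHarmonic n p g} =
      (solidHarmonic (Fin n) ℂ p).map (polyFun (n := n)).toLinearMap := by
    ext g
    exact isSolidHarmonic_iff
  rw [hmap]
  exact Submodule.closed_of_finiteDimensional _

lemma exists_harmonic_tendstoUniformlyOn [n.AtLeastTwo] (hf : HarmonicOnNhd f (ball 0 1)) :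
    ∃ H : ℕ → MvPolynomial (Fin n) ℂ, (∀ k, polyLaplacian (H k) = 0) ∧
      ∀ r < 1, TendstoUniformlyOn (fun k => polyFun (H k)) f atTop (closedBall 0 r) := by
  obtain ⟨u, -, hu, hulim⟩ := exists_seq_strictAnti_tendsto' (zero_lt_one (α := ℝ))
  choose H hH hfH using fun k => exists_harmonic_near hf (r := 1 - u k) (ε := u k)
    (sub_pos.2 (hu k).2) (sub_lt_self 1 (hu k).1) (hu k).1
  refine ⟨H, hH, fun r hr => Metric.tendstoUniformlyOn_iff.2 fun ε hε => ?_⟩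
  filter_upwards [hulim.eventually_lt_const hε, hulim.eventually_lt_const (sub_pos.2 hr)]
    with k hkε hkr x hx
  rw [mem_closedBall_zero_iff] at hx
  rw [dist_eq_norm]
  exact (hfH k x (by linarith)).trans_lt hkε

variable [n.AtLeastTwo]

lemma exists_norm_homogeneousComponent_le (hrs : r < s) (hR : 0 < R) : ∃ K : ℝ, 0 ≤ K ∧
    ∀ Q, polyLaplacian Q = 0 → ∀ M, 0 ≤ M → (∀ x : E n, ‖x‖ = R → ‖polyFun Q x‖ ≤ M) →
      ∀ p, ∀ x : E n, ‖x‖ ≤ r → ‖polyFun (homogeneousComponent p Q) x‖ ≤ K * M * (s / R) ^ p := by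
  obtain ⟨K, hK, hbound⟩ := exists_norm_polyFun_le (n := n) hrs
  refine ⟨K, hK, fun Q hQ M hM hQM p x hx => ?_⟩
  have hs : 0 ≤ s := (norm_nonneg x).trans (hx.trans hrs.le)
  calc ‖polyFun (homogeneousComponent p Q) x‖
      ≤ K * (s ^ p * √(polyNormSq (homogeneousComponent p Q))) :=
        hbound p _ (homogeneousComponent_mem_solidHarmonic hQ p) x hx
    _ = K * (R ^ p * √(polyNormSq (homogeneousComponent p Q))) * (s / R) ^ p := by
        rw [div_pow]
        field_simp
    _ ≤ K * M * (s / R) ^ p := by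
        gcongr
        exact pow_mul_sqrt_polyNormSq_homogeneousComponent_le hQ hR.le hM hQM p

lemma exists_norm_sub_sum_homogeneousComponent_le (hR : 0 < R) (hrR : r < R) :
    ∃ K θ : ℝ, 0 ≤ θ ∧ θ < 1 ∧ ∀ Q, polyLaplacian Q = 0 → ∀ M, 0 ≤ M →
      (∀ x : E n, ‖x‖ = R → ‖polyFun Q x‖ ≤ M) → ∀ N, ∀ x : E n, ‖x‖ ≤ r →
        ‖polyFun Q x - ∑ p ∈ Finset.range N, polyFun (homogeneousComponent p Q) x‖ ≤
          K * M * (θ ^ N / (1 - θ)) := by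
  obtain ⟨s, hs, hsR⟩ := exists_between (max_lt hrR hR)
  obtain ⟨hrs, hs₀⟩ := max_lt_iff.1 hs
  obtain ⟨K, hK, hbound⟩ := exists_norm_homogeneousComponent_le (n := n) hrs hR
  have hθ : s / R < 1 := (div_lt_one hR).2 hsR
  refine ⟨K, s / R, by positivity, hθ, fun Q hQ M hM hQM N x hx => ?_⟩
  set D := max N (Q.totalDegree + 1)
  have hsum : polyFun Q x = ∑ p ∈ Finset.range D, polyFun (homogeneousComponent p Q) x := by
    conv_lhs => rw [← sum_homogeneousComponent Q]
    rw [map_sum, Finset.sum_apply]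
    refine Finset.sum_subset (Finset.range_mono (le_max_right _ _)) fun p _ hp => ?_
    simp [homogeneousComponent_eq_zero p Q (by simpa using hp)]
  rw [hsum, ← Finset.sum_Ico_eq_sub _ (le_max_left _ _)]
  calc _ ≤ ∑ p ∈ Finset.Ico N D, K * M * (s / R) ^ p :=
        norm_sum_le_of_le _ fun p _ => hbound Q hQ M hM hQM p x hx
    _ = K * M * ∑ p ∈ Finset.Ico N D, (s / R) ^ p := (Finset.mul_sum ..).symm
    _ ≤ _ := by
        gcongr
        exact geom_sum_Ico_le_of_lt_one (by positivity) hθ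

lemma cauchySeq_polyFun_homogeneousComponent (hH : ∀ k, polyLaplacian (H k) = 0) (hR : 0 < R)
    (h : UniformCauchySeqOn (fun k => polyFun (H k)) atTop (sphere 0 R)) (p : ℕ) (x : E n) :
    CauchySeq fun k => polyFun (homogeneousComponent p (H k)) x := by
  obtain ⟨K, hK, hbound⟩ := exists_norm_homogeneousComponent_le (n := n) (lt_add_one ‖x‖) hR
  set c := K * ((‖x‖ + 1) / R) ^ p
  have : 0 ≤ c := by positivity
  refine Metric.cauchySeq_iff.2 fun ε hε => ?_
  obtain ⟨N, hN⟩ := Metric.uniformCauchySeqOn_iff.1 h (ε / (c + 1)) (by positivity)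
  refine ⟨N, fun k hk l hl => ?_⟩
  have hkl : ‖polyFun (homogeneousComponent p (H k - H l)) x‖ ≤
      K * (ε / (c + 1)) * ((‖x‖ + 1) / R) ^ p := by
    refine hbound _ (by rw [map_sub, hH, hH, sub_self]) _ (by positivity) (fun y hy => ?_) p x
      le_rfl
    simpa [dist_eq_norm] using (hN k hk l hl y (mem_sphere_zero_iff_norm.2 hy)).le
  calc dist (polyFun (homogeneousComponent p (H k)) x) (polyFun (homogeneousComponent p (H l)) x)
      ≤ K * (ε / (c + 1)) * ((‖x‖ + 1) / R) ^ p := by simpa [dist_eq_norm] using hkl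
    _ = ε * (c / (c + 1)) := by ring
    _ < ε := mul_lt_of_lt_one_right hε ((div_lt_one (by positivity)).2 (lt_add_one c))

lemma exists_isSolidHarmonic_tendsto (hH : ∀ k, polyLaplacian (H k) = 0) (hR : 0 < R)
    (h : UniformCauchySeqOn (fun k => polyFun (H k)) atTop (sphere (0 : E n) R)) :
    ∃ F : ℕ → E n → ℂ, (∀ p, IsSolidHarmonic n p (F p)) ∧
      ∀ p x, Tendsto (fun k => polyFun (homogeneousComponent p (H k)) x) atTop (𝓝 (F p x)) := by
  choose F hF using fun p x =>
    cauchySeq_tendsto_of_complete (cauchySeq_polyFun_homogeneousComponent hH hR h p x)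
  refine ⟨F, fun p => ?_, hF⟩
  exact (isClosed_setOf_isSolidHarmonic n p).mem_of_tendsto (tendsto_pi_nhds.2 (hF p))
    (Eventually.of_forall fun k => isSolidHarmonic_iff.2
      ⟨_, homogeneousComponent_mem_solidHarmonic (hH k) p, rfl⟩)

lemma tendstoUniformlyOn_sum_of_tendsto_homogeneousComponent (hR : 0 < R) (hrR : r < R)
    (hH : ∀ k, polyLaplacian (H k) = 0) (hM : 0 ≤ M)
    (hHM : ∀ᶠ k in atTop, ∀ x : E n, ‖x‖ = R → ‖polyFun (H k) x‖ ≤ M)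
    (hf : ∀ x ∈ closedBall 0 r, Tendsto (fun k => polyFun (H k) x) atTop (𝓝 (f x)))
    (hF : ∀ p x, Tendsto (fun k => polyFun (homogeneousComponent p (H k)) x) atTop (𝓝 (F p x))) :
    TendstoUniformlyOn (fun N x => ∑ p ∈ Finset.range N, F p x) f atTop (closedBall 0 r) := by
  obtain ⟨K, θ, hθ₀, hθ₁, hbound⟩ := exists_norm_sub_sum_homogeneousComponent_le (n := n) hR hrR
  have htail (N : ℕ) (x : E n) (hx : x ∈ closedBall 0 r) :
      ‖f x - ∑ p ∈ Finset.range N, F p x‖ ≤ K * M * (θ ^ N / (1 - θ)) := by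
    refine le_of_tendsto
      ((hf x hx).sub (tendsto_finsetSum (Finset.range N) fun p _ => hF p x)).norm ?_
    filter_upwards [hHM] with k hk
    exact hbound _ (hH k) M hM hk N x (mem_closedBall_zero_iff.1 hx)
  have hlim : Tendsto (fun N : ℕ => K * M * (θ ^ N / (1 - θ))) atTop (𝓝 0) := by
    simpa using ((tendsto_pow_atTop_nhds_zero_of_lt_one hθ₀ hθ₁).div_const (1 - θ)).const_mul
      (K * M)
  refine Metric.tendstoUniformlyOn_iff.2 fun ε hε => ?_
  filter_upwards [hlim.eventually_lt_const hε] with N hN x hx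
  rw [dist_eq_norm]
  exact (htail N x hx).trans_lt hN

lemma exists_isHarmonicExpansion (hf : HarmonicOnNhd f (ball 0 1)) :
    ∃ F, IsHarmonicExpansion n f F := by
  obtain ⟨H, hH, hlim⟩ := exists_harmonic_tendstoUniformlyOn hf
  obtain ⟨F, hsolid, hF⟩ := exists_isSolidHarmonic_tendsto hH one_half_pos
    ((hlim _ one_half_lt_one).uniformCauchySeqOn.mono sphere_subset_closedBall)
  refine ⟨F, hsolid, tendstoLocallyUniformlyOn_ball_iff.2 fun r hr => ?_⟩
  obtain ⟨R, hR, hR₁⟩ := exists_between (max_lt hr one_pos)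
  obtain ⟨hrR, hR₀⟩ := max_lt_iff.1 hR
  obtain ⟨B, hB⟩ := (isCompact_closedBall (0 : E n) R).exists_bound_of_continuousOn
    (hf.continuousOn.mono (closedBall_subset_ball hR₁))
  have hB₀ : 0 ≤ B := (norm_nonneg _).trans (hB 0 (mem_closedBall_self hR₀.le))
  refine tendstoUniformlyOn_sum_of_tendsto_homogeneousComponent (M := B + 1) hR₀ hrR hH
    (by positivity) ?_ (fun x hx => (hlim r hr).tendsto_at hx) hF
  filter_upwards [Metric.tendstoUniformlyOn_iff.1 (hlim R hR₁) 1 one_pos] with k hk x hx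
  have hx' : x ∈ closedBall 0 R := mem_closedBall_zero_iff.2 hx.le
  calc ‖polyFun (H k) x‖ ≤ ‖f x‖ + ‖polyFun (H k) x - f x‖ := norm_le_norm_add_norm_sub' _ _
    _ ≤ B + 1 := add_le_add (hB x hx') (by simpa [dist_eq_norm, norm_sub_rev] using (hk x hx').le)

lemma isHarmonicExpansion_component (hf : HarmonicOnNhd f (ball 0 1)) :
    IsHarmonicExpansion n f (component n f) :=
  Classical.epsilon_spec (exists_isHarmonicExpansion hf)

end Existence

section WeightedSeminorm

variable {n : ℕ} {f g : E n → ℂ} {a b : ℕ → ℝ} {C : ℝ}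

/-- The squared norm `∑ₚ a p ‖f_p‖²` with weights `a`. The Dirichlet weights give `dirichletNormSq`
by definition, and the weights `tangentialWeight n m` give `tangentialNormSq n m`. -/
def weightedNormSq (n : ℕ) (a : ℕ → ℝ) (f : E n → ℂ) : ℝ≥0∞ :=
  ∑' p, ENNReal.ofReal (a p) * sphereNormSq n (component n f p)

lemma weightedNormSq_le_mul (hC : 0 ≤ C) (h : ∀ p, a p ≤ C * b p) (f : E n → ℂ) :
    weightedNormSq n a f ≤ ENNReal.ofReal C * weightedNormSq n b f := by
  simp only [weightedNormSq, ← ENNReal.tsum_mul_left, ← mul_assoc, ← ENNReal.ofReal_mul hC]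
  gcongr with p
  exact h p

/-- The measure on `ℕ × Sⁿ⁻¹` whose restriction to the `p`-th sphere is `a p • dσ`. Its `L²` norm
turns `weightedNormSq` into the square of a Hilbert space norm. -/
def weightedSphereMeasure (n : ℕ) (a : ℕ → ℝ) : Measure (ℕ × sphere (0 : E n) 1) :=
  Measure.sum fun p => ENNReal.ofReal (a p) • (sphereMeasure n).map (Prod.mk p)

lemma lintegral_weightedSphereMeasure (F : ℕ × sphere (0 : E n) 1 → ℝ≥0∞) :
    ∫⁻ q, F q ∂(weightedSphereMeasure n a) =
      ∑' p, ENNReal.ofReal (a p) * ∫⁻ ζ, F (p, ζ) ∂(sphereMeasure n) := by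
  simp only [weightedSphereMeasure, lintegral_sum_measure, lintegral_smul_measure, smul_eq_mul,
    (measurableEmbedding_prodMk_left _).lintegral_map]

/-- The restrictions to the unit sphere of all the components of `f`, as one function. -/
def sphereComponents (n : ℕ) (f : E n → ℂ) (q : ℕ × sphere (0 : E n) 1) : ℂ :=
  component n f q.1 q.2

lemma weightedNormSq_eq_eLpNorm_sq (a : ℕ → ℝ) (f : E n → ℂ) :
    weightedNormSq n a f = eLpNorm (sphereComponents n f) 2 (weightedSphereMeasure n a) ^ 2 := by
  have h := eLpNorm_nnreal_pow_eq_lintegral (f := sphereComponents n f)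
    (μ := weightedSphereMeasure n a) (p := 2) two_ne_zero
  simp only [ENNReal.coe_ofNat, NNReal.coe_ofNat, ENNReal.rpow_two] at h
  rw [h, lintegral_weightedSphereMeasure]
  rfl

variable [n.AtLeastTwo]

lemma sphereComponents_add (hf : HarmonicOnNhd f (ball 0 1)) (hg : HarmonicOnNhd g (ball 0 1)) :
    sphereComponents n (f + g) = sphereComponents n f + sphereComponents n g := by
  have h := ((isHarmonicExpansion_component hf).add (isHarmonicExpansion_component hg)).component_eq
  funext q
  simp only [sphereComponents, h, Pi.add_apply]

lemma sphereComponents_smul (hf : HarmonicOnNhd f (ball 0 1)) (c : ℂ) :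
    sphereComponents n (c • f) = c • sphereComponents n f := by
  have h := ((isHarmonicExpansion_component hf).smul c).component_eq
  funext q
  simp only [sphereComponents, h, Pi.smul_apply]

lemma continuous_sphereComponents (hf : HarmonicOnNhd f (ball 0 1)) :
    Continuous (sphereComponents n f) := by
  refine continuous_prod_of_discrete_left.2 fun p => ?_
  obtain ⟨P, -, hP⟩ := isSolidHarmonic_iff.1 ((isHarmonicExpansion_component hf).solid p)
  simp only [sphereComponents, ← hP]
  exact (continuous_polyFun P).comp continuous_subtype_val

lemma memLp_sphereComponents_iff (hf : HarmonicOnNhd f (ball 0 1)) :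
    MemLp (sphereComponents n f) 2 (weightedSphereMeasure n a) ↔ weightedNormSq n a f < ∞ := by
  simp [MemLp, weightedNormSq_eq_eLpNorm_sq, (continuous_sphereComponents hf).aestronglyMeasurable]

/-- The space of the harmonic functions on the unit ball with `∑ₚ a p ‖f_p‖² < ∞`. -/
def weightedSpace (n : ℕ) [n.AtLeastTwo] (a : ℕ → ℝ) : Submodule ℂ (E n → ℂ) where
  carrier := {f | HarmonicOnNhd f (ball 0 1) ∧ weightedNormSq n a f < ∞}
  zero_mem' := by
    have hzero : HarmonicOnNhd (0 : E n → ℂ) (ball 0 1) := harmonicOnNhd_const 0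
    refine ⟨hzero, (memLp_sphereComponents_iff hzero).1 ?_⟩
    have h := sphereComponents_smul hzero 0
    rw [zero_smul, zero_smul] at h
    exact h ▸ MemLp.zero
  add_mem' := by
    rintro f g ⟨hf, hfa⟩ ⟨hg, hga⟩
    refine ⟨hf.add hg, (memLp_sphereComponents_iff (hf.add hg)).1 ?_⟩
    rw [sphereComponents_add hf hg]
    exact ((memLp_sphereComponents_iff hf).2 hfa).add ((memLp_sphereComponents_iff hg).2 hga)
  smul_mem' := by
    rintro c f ⟨hf, hfa⟩
    have hcf : HarmonicOnNhd (c • f) (ball 0 1) := hf.comp_CLM (ContinuousLinearMap.lsmul ℝ ℂ c)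
    refine ⟨hcf, (memLp_sphereComponents_iff hcf).1 ?_⟩
    rw [sphereComponents_smul hf c]
    exact ((memLp_sphereComponents_iff hf).2 hfa).const_smul c

lemma weightedSpace_mono (hC : 0 ≤ C) (h : ∀ p, a p ≤ C * b p) :
    weightedSpace n b ≤ weightedSpace n a := fun f hf =>
  ⟨hf.1, (weightedNormSq_le_mul hC h f).trans_lt (ENNReal.mul_lt_top ENNReal.ofReal_lt_top hf.2)⟩

/-- The linear map from `weightedSpace n a` to `L²(weightedSphereMeasure n a)` given by
`sphereComponents`. -/
def sphereComponentsLp (n : ℕ) [n.AtLeastTwo] (a : ℕ → ℝ) :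
    weightedSpace n a →ₗ[ℂ] Lp ℂ 2 (weightedSphereMeasure n a) where
  toFun f := ((memLp_sphereComponents_iff f.2.1).2 f.2.2).toLp
  map_add' f g := by
    rw [← MemLp.toLp_add]
    exact MemLp.toLp_congr _ _ (ae_of_all _ (congrFun (sphereComponents_add f.2.1 g.2.1)))
  map_smul' c f := by
    rw [RingHom.id_apply, ← MemLp.toLp_const_smul]
    exact MemLp.toLp_congr _ _ (ae_of_all _ (congrFun (sphereComponents_smul f.2.1 c)))

/-- The seminorm `f ↦ (∑ₚ a p ‖f_p‖²)^(1/2)`, pulled back from `L²(weightedSphereMeasure n a)`. -/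
def weightedSeminorm (n : ℕ) [n.AtLeastTwo] (a : ℕ → ℝ) : Seminorm ℂ (weightedSpace n a) :=
  (normSeminorm ℂ (Lp ℂ 2 (weightedSphereMeasure n a))).comp (sphereComponentsLp n a)

lemma weightedSeminorm_apply (f : weightedSpace n a) :
    weightedSeminorm n a f = √(weightedNormSq n a f).toReal := by
  rw [weightedNormSq_eq_eLpNorm_sq, ENNReal.toReal_pow, Real.sqrt_sq ENNReal.toReal_nonneg]
  exact Lp.norm_toLp _ ((memLp_sphereComponents_iff f.2.1).2 f.2.2)

lemma weightedSeminorm_inclusion_le (hC : 0 ≤ C) (h : ∀ p, a p ≤ C * b p)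
    (f : weightedSpace n b) :
    weightedSeminorm n a (Submodule.inclusion (weightedSpace_mono hC h) f) ≤
      √C * weightedSeminorm n b f := by
  rw [weightedSeminorm_apply, weightedSeminorm_apply, ← Real.sqrt_mul hC]
  refine Real.sqrt_le_sqrt ?_
  have hfinite : weightedNormSq n b f < ∞ := f.2.2
  have hle := ENNReal.toReal_mono (ENNReal.mul_ne_top ENNReal.ofReal_ne_top hfinite.ne)
    (weightedNormSq_le_mul hC h (f : E n → ℂ))
  rwa [ENNReal.toReal_mul, ENNReal.toReal_ofReal hC] at hle

end WeightedSeminorm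

section TangentialSeminorm

variable {n m : ℕ}

lemma ne_zero_of_div_four_lt (hm : (n : ℝ) / 4 < m) : m ≠ 0 :=
  (Nat.cast_pos.1 ((by positivity : (0 : ℝ) ≤ n / 4).trans_lt hm)).ne'

variable [n.AtLeastTwo] {f : E n → ℂ}

lemma tangentialNormSq_eq_weightedNormSq (hf : HarmonicOnNhd f (ball 0 1)) (hm : (n : ℝ) / 4 < m) :
    tangentialNormSq n m f = weightedNormSq n (tangentialWeight n m) f :=
  (isHarmonicExpansion_component hf).tangentialNormSq_eq_tsum hm

lemma weightedSpace_tangentialWeight (hm : m ≠ 0) :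
    weightedSpace n (tangentialWeight n m) = weightedSpace n (dirichletCoeff n) := by
  obtain ⟨c, C, hc, hC, h⟩ := exists_tangentialWeight_bounds (n := n) hm
  exact (weightedSpace_mono (inv_nonneg.2 hc.le) fun p => (le_inv_mul_iff₀ hc).2 (h p).1).antisymm
    (weightedSpace_mono hC.le fun p => (h p).2)

lemma mem_harmonicDirichletSpace_iff (hf : HarmonicOnNhd f (ball 0 1)) (hm : (n : ℝ) / 4 < m) :
    f ∈ harmonicDirichletSpace n ↔ tangentialNormSq n m f < ∞ := by
  change f ∈ weightedSpace n (dirichletCoeff n) ↔ _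
  rw [← weightedSpace_tangentialWeight (ne_zero_of_div_four_lt hm),
    tangentialNormSq_eq_weightedNormSq hf hm]
  exact and_iff_right hf

/-- The seminorm `f ↦ S_m(f)^(1/2)` on the harmonic Dirichlet space. -/
def tangentialSeminorm (n : ℕ) [n.AtLeastTwo] {m : ℕ} (hm : m ≠ 0) :
    Seminorm ℂ (weightedSpace n (dirichletCoeff n)) :=
  (weightedSeminorm n (tangentialWeight n m)).comp
    (Submodule.inclusion (weightedSpace_tangentialWeight hm).ge)

lemma tangentialSeminorm_apply (hm : (n : ℝ) / 4 < m) (f : weightedSpace n (dirichletCoeff n)) :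
    tangentialSeminorm n (ne_zero_of_div_four_lt hm) f = √(tangentialNormSq n m f).toReal := by
  have hf : HarmonicOnNhd (f : E n → ℂ) (ball 0 1) := f.2.1
  rw [tangentialNormSq_eq_weightedNormSq hf hm, tangentialSeminorm, Seminorm.comp_apply,
    weightedSeminorm_apply, Submodule.coe_inclusion]

lemma exists_tangentialSeminorm_bounds (hm : m ≠ 0) : ∃ c C : ℝ, 0 < c ∧ 0 < C ∧
    ∀ f, c * weightedSeminorm n (dirichletCoeff n) f ≤ tangentialSeminorm n hm f ∧
      tangentialSeminorm n hm f ≤ C * weightedSeminorm n (dirichletCoeff n) f := by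
  obtain ⟨c, C, hc, hC, h⟩ := exists_tangentialWeight_bounds (n := n) hm
  refine ⟨√c, √C, Real.sqrt_pos.2 hc, Real.sqrt_pos.2 hC, fun f => ⟨?_, ?_⟩⟩
  · rw [← le_inv_mul_iff₀ (Real.sqrt_pos.2 hc), ← Real.sqrt_inv]
    exact weightedSeminorm_inclusion_le (inv_nonneg.2 hc.le)
      (fun p => (le_inv_mul_iff₀ hc).2 (h p).1) (Submodule.inclusion _ f)
  · exact weightedSeminorm_inclusion_le hC.le (fun p => (h p).2) f

end TangentialSeminorm

end HarmonicDirichlet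

end

open HarmonicDirichlet in
theorem mainTheorem8 (n : ℕ) (hn : 2 ≤ n) :
    (∀ f : E n → ℂ, HarmonicOnNhd f (ball (0 : E n) 1) →
      (∃! F : ℕ → E n → ℂ, IsHarmonicExpansion n f F) ∧
      (f ∈ harmonicDirichletSpace n ↔
        ∃ m : ℕ, (n : ℝ) / 4 < (m : ℝ) ∧ tangentialNormSq n m f < ∞) ∧
      (f ∈ harmonicDirichletSpace n ↔
        ∀ m : ℕ, (n : ℝ) / 4 < (m : ℝ) → tangentialNormSq n m f < ∞)) ∧
    ∃ V : Submodule ℂ (E n → ℂ), (V : Set (E n → ℂ)) = harmonicDirichletSpace n ∧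
      ∃ q₀ : Seminorm ℂ V,
        (∀ f : V, q₀ f = Real.sqrt (dirichletNormSq n (f : E n → ℂ)).toReal) ∧
        ∀ m : ℕ, (n : ℝ) / 4 < (m : ℝ) →
          ∃ q : Seminorm ℂ V,
            (∀ f : V, q f = Real.sqrt (tangentialNormSq n m (f : E n → ℂ)).toReal) ∧
            ∃ c C : ℝ, 0 < c ∧ 0 < C ∧ ∀ f : V, c * q₀ f ≤ q f ∧ q f ≤ C * q₀ f := by
  have : n.AtLeastTwo := ⟨hn⟩
  have hn4 : (n : ℝ) / 4 < n := by
    have : (0 : ℝ) < n := Nat.cast_pos.2 (by lia)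
    linarith
  refine ⟨fun f hf => ⟨?_, ?_, ?_⟩, weightedSpace n (dirichletCoeff n), rfl,
    weightedSeminorm n (dirichletCoeff n), weightedSeminorm_apply, fun m hm =>
      ⟨tangentialSeminorm n (ne_zero_of_div_four_lt hm), tangentialSeminorm_apply hm,
        exists_tangentialSeminorm_bounds _⟩⟩
  · obtain ⟨F, hF⟩ := exists_isHarmonicExpansion hf
    exact ⟨F, hF, fun G hG => hG.unique hF⟩
  · exact ⟨fun h => ⟨n, hn4, (mem_harmonicDirichletSpace_iff hf hn4).1 h⟩,
      fun ⟨m, hm, h⟩ => (mem_harmonicDirichletSpace_iff hf hm).2 h⟩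
  · exact ⟨fun h m hm => (mem_harmonicDirichletSpace_iff hf hm).1 h,
      fun h => (mem_harmonicDirichletSpace_iff hf hn4).2 (h n hn4)⟩
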